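/- **Setting.** There are $n$ experts with signal spaces $S_1,\dots,S_n$, which are arbitrary measurable spaces (finite or infinite), and a binary event $\omega\in\{0,1\}$. Let $P$ be a joint distribution of the signals $s=(s_1,\dots,s_n)$ and $\omega$. Expert $i$ reports $r_i=P(\omega=1\mid s_i)$, and $r=(r_1,\dots,r_n)$. An aggregator is a (measurable) function $f:[0,1]^n\to[0,1]$, with loss $L_P(f)=\mathbb E_P\big[|f(r)-\omega|^2\big]$. Let $f^*$ be an optimal aggregator, that is, a minimiser of $L_P$ over all aggregators (it is unique up to $P$-almost sure equality). An aggregator $f$ is $\varepsilon$-optimal for $P$ if $\mathbb E_P\big[|f(r)-f^*(r)|^2\big]\le\varepsilon$. For a family $\mathcal P$ of distributions and $\varepsilon,\delta\in(0,1)$, we say that $T$ samples suffice if there is a (possibly randomised) learning procedure that, given $T$ i.i.d. samples $(r^{(t)},\omega^{(t)})$ of reports and event drawn from $P$, outputs for every $P\in\mathcal P$ an $\varepsilon$-optimal aggregator for $P$ with probability at least $1-\delta$ over the samples and the randomness of the procedure. The procedure may depend on $\mathcal P,\varepsilon,\delta,T$ but not on $P$. The sample complexity $T_{\mathcal P}(\varepsilon,\delta)$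 is the least $N\in\mathbb N$ such that every number $T\ge N$ of samples suffices (and $+\infty$ if there is no such $N$). Let $\mathcal P_{\mathrm{ind}}$ be the family of all conditionally independent distributions: those with $P(\omega=1)\in(0,1)$ for which $s_1,\dots,s_n$ are independent conditionally on $\omega=0$ and conditionally on $\omega=1$. **Theorem.** There are absolute constants $C,c>0$ and $\varepsilon_0,\delta_0\in(0,1)$ such that for all $n\ge 2$ and all signal spaces $S_1,\dots,S_n$ the following hold. 1. For all $\varepsilon,\delta\in(0,1)$, $$T_{\mathcal P_{\mathrm{ind}}}(\varepsilon,\delta)\;\le\; \frac{C}{\varepsilon^2}\log\frac1{\varepsilon\delta}.$$ 2. If every $S_i$ is non-trivial, i.e. has a measurable subset that is neither empty nor all of $S_i$ (for a finite $S_i$ with all subsets measurable: $|S_i|\ge 2$), then for all $\varepsilon\in(0,\varepsilon_0]$ and $\delta\in(0,\delta_0]$, $$T_{\mathcal P_{\mathrm{ind}}}(\varepsilon,\delta)\;\ge\; \frac{c}{\varepsilon}\log\frac1\delta.$$ -/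

import Mathlib

open MeasureTheory ProbabilityTheory unitInterval
open scoped ENNReal

namespace ForecastAggregation

noncomputable section

/-- The value in `{0, 1}` of the binary event. -/
def eventValue (ω : Bool) : ℝ := if ω then 1 else 0

/-- A joint distribution of the signals `s = (s_1, …, s_n)` and of the event `ω`. The signal spaces
`S i` are arbitrary measurable spaces, finite or infinite. -/
abbrev Distribution {n : ℕ} (S : Fin n → Type*) [∀ i, MeasurableSpace (S i)] : Type _ :=
  ProbabilityMeasure ((∀ i, S i) × Bool)

/-- A joint report `r = (r_1, …, r_n) ∈ [0, 1]^n`. -/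
abbrev Reports (n : ℕ) : Type := Fin n → I

/-- One data point `(r, ω)`. -/
abbrev Sample (n : ℕ) : Type := Reports n × Bool

section Model

variable {n : ℕ} {S : Fin n → Type*} [∀ i, MeasurableSpace (S i)]

/-- The report `r_i = P(ω = 1 | s_i)` of expert `i` upon the signal `s_i`: the value on `{ω = 1}` of
the regular conditional distribution of `ω` given the `i`-th signal. -/
def report (P : Distribution S) (i : Fin n) (s : S i) : I :=
  ⟨(condDistrib (fun x : (∀ j, S j) × Bool => x.2) (fun x => x.1 i)
      (P : Measure ((∀ j, S j) × Bool)) s).real {true},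
    measureReal_nonneg, measureReal_le_one⟩

/-- The law of `(r, ω)` when `(s, ω) ∼ P` and `r_i = P(ω = 1 | s_i)`. -/
def reportLaw (P : Distribution S) : Measure (Sample n) :=
  (P : Measure ((∀ i, S i) × Bool)).map (fun x => (fun i => report P i (x.1 i), x.2))

/-- The mean squared loss `L_P(f) = E_P |f(r) - ω|²` of an aggregator. -/
def loss (P : Distribution S) (f : Reports n → I) : ℝ :=
  ∫ z, ((f z.1 : ℝ) - eventValue z.2) ^ 2 ∂(reportLaw P)

/-- `f` is an optimal aggregator: it minimises the loss over all (measurable) aggregators. -/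
def IsOptimal (P : Distribution S) (f : Reports n → I) : Prop :=
  Measurable f ∧ ∀ g : Reports n → I, Measurable g → loss P f ≤ loss P g

/-- `f` is `ε`-optimal: `E_P |f(r) - f*(r)|² ≤ ε`, where `f*` is the optimal aggregator (which is
unique up to almost sure equality). -/
def IsEpsOptimal (P : Distribution S) (ε : ℝ) (f : Reports n → I) : Prop :=
  ∃ fstar : Reports n → I, IsOptimal P fstar ∧
    ∫ z, ((f z.1 : ℝ) - (fstar z.1 : ℝ)) ^ 2 ∂(reportLaw P) ≤ ε

end Model

/-- A possibly randomised learning procedure that turns `T` data points into an aggregator; its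
internal randomness is a random seed independent of the data. -/
structure Learner (n T : ℕ) where
  Seed : Type
  measurableSpaceSeed : MeasurableSpace Seed
  seedLaw : ProbabilityMeasure Seed
  output : Seed → (Fin T → Sample n) → Reports n → I
  measurable_output :
    Measurable (fun x : Seed × (Fin T → Sample n) × Reports n => output x.1 x.2.1 x.2.2)

attribute [instance] Learner.measurableSpaceSeed

section Complexity

variable {n : ℕ} {S : Fin n → Type*} [∀ i, MeasurableSpace (S i)]

/-- The joint law of the seed and of `T` independent data points drawn from `P`. -/
def trainingLaw {T : ℕ} (A : Learner n T) (P : Distribution S) :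
    Measure (A.Seed × (Fin T → Sample n)) :=
  (A.seedLaw : Measure A.Seed).prod (Measure.pi (fun _ : Fin T => reportLaw P))

/-- `T` samples suffice: one learning procedure, not knowing which `P` in the family is the true
distribution, outputs an `ε`-optimal aggregator with probability at least `1 - δ` for every `P`. -/
def SamplesSuffice (Q : Set (Distribution S)) (ε δ : ℝ) (T : ℕ) : Prop :=
  ∃ A : Learner n T, ∀ P ∈ Q,
    ENNReal.ofReal (1 - δ) ≤ trainingLaw A P {x | IsEpsOptimal P ε (A.output x.1 x.2)}

/-- The sample complexity of forecast aggregation with respect to `Q`: the least `N` such that every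
`T ≥ N` samples suffice, and `⊤` if there is no such `N`. -/
def sampleComplexity (Q : Set (Distribution S)) (ε δ : ℝ) : ℕ∞ :=
  ⨅ (N : ℕ) (_ : ∀ T : ℕ, N ≤ T → SamplesSuffice Q ε δ T), (N : ℕ∞)

end Complexity

/-- The family of all conditionally independent distributions: the prior `p = P(ω = 1)` lies in
`(0, 1)` and, conditionally on each of the two values of `ω`, the signals are independent. -/
def condIndepFamily {n : ℕ} (S : Fin n → Type*) [∀ i, MeasurableSpace (S i)] :
    Set (Distribution S) :=
  {P | (P : Measure ((∀ i, S i) × Bool)).real {x | x.2 = true} ∈ Set.Ioo (0 : ℝ) 1 ∧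
    ∀ ω : Bool, iIndepFun (fun (i : Fin n) (x : (∀ j, S j) × Bool) => x.1 i)
      (ProbabilityTheory.cond (P : Measure ((∀ i, S i) × Bool)) {x | x.2 = ω})}

end

end ForecastAggregation

/- Under conditional independence, Bayes' rule turns the likelihood ratio of each signal into one of
its report, so the optimal aggregator belongs to a family of aggregators that depends on a single
real parameter, in which it is increasing and continuous.

Upper bound: a posterior forecast has mean prediction error `0`, and a forecast comparable with it
pointwise differs from it in mean square by at most its own mean prediction error. So it suffices
to choose a parameter of almost vanishing empirical mean error. As the mean and the empirical mean
of the error are monotone in the parameter, Hoeffding's inequality at three parameters controls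
this choice.

Lower bound: take signals uninformative enough for the report profile `(1/2, …, 1/2)` to have
probability at least `1/9`. Two such laws whose optimal forecasts at this profile are `sigmoid 1`
and `sigmoid (1 + κ)`, with `κ ^ 2` of order `ε`, share no `ε`-optimal aggregator, although the
`χ²`-divergence between them is only of order `κ ^ 2`, uniformly in the number of experts. -/

namespace ForecastAggregation

noncomputable section

section Posterior

variable {α β : Type*} [MeasurableSpace α] [MeasurableSpace β] {μ : Measure (α × Bool)}
  {f g : α → I}

/-- The probability `p` or `1 - p` which a forecast `p` of a binary event assigns to the value `v`
of the event. -/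
def outcomeProb (p : I) (v : Bool) : I := if v then p else σ p

/-- The finite measure `D ↦ μ (D × {v})`: the part of the law of `a` on which the event has the
value `v`, when `(a, ω) ∼ μ`. -/
def eventPart (μ : Measure (α × Bool)) (v : Bool) : Measure α :=
  (μ.restrict {z | z.2 = v}).map Prod.fst

/-- `f` is a version of the posterior probability `a ↦ P(ω = 1 | a)` when `(a, ω) ∼ μ`. -/
structure IsPosterior (μ : Measure (α × Bool)) (f : α → I) : Prop where
  measurable : Measurable f
  eventPart_true : eventPart μ true = μ.fst.withDensity fun a => ENNReal.ofReal (f a)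

@[fun_prop]
theorem measurable_outcomeProb (v : Bool) : Measurable fun p => outcomeProb p v := by
  cases v <;> simp only [outcomeProb, if_true, Bool.false_eq_true, if_false]
  · exact continuous_symm.measurable
  · exact measurable_id

theorem measurableSet_snd_eq (v : Bool) : MeasurableSet {z : α × Bool | z.2 = v} :=
  measurable_snd (measurableSet_singleton v)

instance [IsFiniteMeasure μ] (v : Bool) : IsFiniteMeasure (eventPart μ v) := by
  unfold eventPart; infer_instance

theorem eventPart_apply (v : Bool) {D : Set α} (hD : MeasurableSet D) :
    eventPart μ v D = μ (D ×ˢ {v}) := by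
  rw [eventPart, Measure.map_apply measurable_fst hD,
    Measure.restrict_apply (measurable_fst hD)]
  rfl

theorem lintegral_eq_sum_eventPart {h : α × Bool → ℝ≥0∞} (hh : Measurable h) :
    ∫⁻ z, h z ∂μ = ∑ v, ∫⁻ a, h (a, v) ∂eventPart μ v := by
  have hpart : ∀ v, ∫⁻ a, h (a, v) ∂eventPart μ v = ∫⁻ z in {z | z.2 = v}, h z ∂μ := by
    intro v
    rw [eventPart, lintegral_map (by fun_prop) measurable_fst]
    refine setLIntegral_congr_fun (measurableSet_snd_eq v) ?_
    rintro ⟨a, _⟩ rfl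
    rfl
  have hcompl : {z : α × Bool | z.2 = false} = {z | z.2 = true}ᶜ := by ext; simp
  simp_rw [hpart, Fintype.sum_bool, hcompl]
  exact (lintegral_add_compl h (measurableSet_snd_eq true)).symm

theorem fst_eq_eventPart_add : μ.fst = eventPart μ true + eventPart μ false := by
  ext D hD
  rw [Measure.fst_apply hD, ← lintegral_indicator_one (measurable_fst hD),
    lintegral_eq_sum_eventPart (measurable_one.indicator (measurable_fst hD)), Fintype.sum_bool,
    Measure.add_apply, ← lintegral_indicator_one hD, ← lintegral_indicator_one hD]
  rfl

theorem eventPart_map {φ : α → β} (hφ : Measurable φ) (v : Bool) :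
    eventPart (μ.map (Prod.map φ id)) v = (eventPart μ v).map φ := by
  have hφ' : Measurable (Prod.map φ (id : Bool → Bool)) := hφ.prodMap measurable_id
  ext D hD
  rw [eventPart_apply v hD, Measure.map_apply hφ' (hD.prod (measurableSet_singleton v)),
    Measure.map_apply hφ hD, eventPart_apply v (hφ hD)]
  rfl

theorem IsPosterior.eventPart_eq [IsFiniteMeasure μ] (hf : IsPosterior μ f) (v : Bool) :
    eventPart μ v = μ.fst.withDensity fun a => ENNReal.ofReal (outcomeProb (f a) v) := by
  cases v with
  | true => exact hf.eventPart_true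
  | false =>
    have hm : Measurable fun a => ENNReal.ofReal (f a) :=
      (measurable_subtype_coe.comp hf.measurable).ennreal_ofReal
    have hone : ∀ a, ENNReal.ofReal (f a) + ENNReal.ofReal (outcomeProb (f a) false) = 1 := by
      intro a
      rw [← ENNReal.ofReal_add (f a).2.1 (outcomeProb (f a) false).2.1]
      simp [outcomeProb]
    ext D _
    have hsum := congrArg (· D) (fst_eq_eventPart_add (μ := μ))
    have hsplit : μ.fst D = eventPart μ true D +
        μ.fst.withDensity (fun a => ENNReal.ofReal (outcomeProb (f a) false)) D := by
      rw [hf.eventPart_true, ← Measure.add_apply, ← withDensity_add_left hm]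
      simp_rw [Pi.add_def, hone]
      exact (congrArg (· D) (withDensity_one (μ := μ.fst))).symm
    exact (ENNReal.add_right_inj (measure_ne_top _ _)).1 (hsum.symm.trans hsplit)

theorem IsPosterior.map {φ : α → β} (hφ : Measurable φ) {g : β → I} (hg : Measurable g)
    (h : IsPosterior μ (g ∘ φ)) : IsPosterior (μ.map (Prod.map φ id)) g := by
  refine ⟨hg, ?_⟩
  have hfst : (μ.map (Prod.map φ (id : Bool → Bool))).fst = μ.fst.map φ := by
    simp only [fst_eq_eventPart_add, eventPart_map hφ, Measure.map_add _ _ hφ]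
  ext D hD
  rw [eventPart_map hφ, h.eventPart_true, Measure.map_apply hφ hD,
    withDensity_apply _ (hφ hD), hfst, withDensity_apply _ hD,
    setLIntegral_map hD (by fun_prop) hφ]
  rfl

theorem IsPosterior.ae_eq [IsFiniteMeasure μ] (hf : IsPosterior μ f) (hg : IsPosterior μ g) :
    f =ᵐ[μ.fst] g := by
  have hmf := hf.measurable
  have hmg := hg.measurable
  have h := hf.eventPart_true.symm.trans hg.eventPart_true
  rw [withDensity_eq_iff_of_sigmaFinite (by fun_prop) (by fun_prop)] at h
  filter_upwards [h] with a ha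
  exact Subtype.ext ((ENNReal.ofReal_eq_ofReal_iff (f a).2.1 (g a).2.1).1 ha)

end Posterior

section Loss

variable {α : Type*} [MeasurableSpace α] {μ : Measure (α × Bool)} {f g : α → I}

theorem eventValue_mem (v : Bool) : eventValue v ∈ I := by
  cases v <;> simp [eventValue]

@[fun_prop]
theorem measurable_eventValue : Measurable eventValue := measurable_of_countable _

theorem abs_sub_le_one {a b : ℝ} (ha : a ∈ I) (hb : b ∈ I) : |a - b| ≤ 1 :=
  abs_le.2 ⟨by linarith [ha.1, hb.2], by linarith [ha.2, hb.1]⟩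

theorem integrable_sub [IsFiniteMeasure μ] (hf : Measurable f) (hg : Measurable g) :
    Integrable (fun a => (g a - f a : ℝ)) μ.fst :=
  .of_bound (by fun_prop) 1 (.of_forall fun a => abs_sub_le_one (g a).2 (f a).2)

theorem integrable_sq_sub [IsFiniteMeasure μ] (hf : Measurable f) (hg : Measurable g) :
    Integrable (fun z => (g z.1 - f z.1 : ℝ) ^ 2) μ :=
  .of_bound (by fun_prop) 1 (.of_forall fun z => by
    rw [norm_pow]
    exact pow_le_one₀ (norm_nonneg _) (abs_sub_le_one (g z.1).2 (f z.1).2))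

theorem integrable_sub_eventValue [IsFiniteMeasure μ] (hf : Measurable f) :
    Integrable (fun z => (f z.1 : ℝ) - eventValue z.2) μ :=
  .of_bound (by fun_prop) 1
    (.of_forall fun z => abs_sub_le_one (f z.1).2 (eventValue_mem z.2))

theorem IsPosterior.integral_mul_eventValue (hf : IsPosterior μ f) {h : α → ℝ}
    (hh : Measurable h) :
    ∫ z, h z.1 * eventValue z.2 ∂μ = ∫ z, h z.1 * f z.1 ∂μ := by
  have hmf := hf.measurable
  calc ∫ z, h z.1 * eventValue z.2 ∂μ = ∫ z in {z | z.2 = true}, h z.1 ∂μ := by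
        rw [← integral_indicator (measurableSet_snd_eq true)]
        refine integral_congr_ae (.of_forall fun z => ?_)
        rcases z with ⟨a, _ | _⟩ <;> simp [eventValue]
    _ = ∫ a, h a ∂eventPart μ true :=
        (integral_map measurable_fst.aemeasurable hh.aestronglyMeasurable).symm
    _ = ∫ a, f a * h a ∂μ.fst := by
        rw [hf.eventPart_true, integral_withDensity_eq_integral_toReal_smul (by fun_prop)
          (.of_forall fun _ => ENNReal.ofReal_lt_top)]
        simp only [ENNReal.toReal_ofReal (f _).2.1, smul_eq_mul]
    _ = ∫ z, h z.1 * f z.1 ∂μ := by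
        rw [Measure.fst, integral_map measurable_fst.aemeasurable (by fun_prop)]
        simp only [mul_comm]

theorem IsPosterior.integral_mul_sub_eventValue [IsFiniteMeasure μ] (hf : IsPosterior μ f)
    {h : α → ℝ} (hh : Measurable h) (hint : Integrable h μ.fst) :
    ∫ z, h z.1 * (f z.1 - eventValue z.2) ∂μ = 0 := by
  have hmf := hf.measurable
  have hint' : Integrable (fun z : α × Bool => h z.1) μ := hint.comp_measurable measurable_fst
  have hbound : ∀ {x : ℝ}, x ∈ I → ‖x‖ ≤ 1 := fun hx => abs_le.2 ⟨by linarith [hx.1], hx.2⟩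
  simp_rw [mul_sub]
  rw [integral_sub
      (hint'.mul_bdd (Measurable.aestronglyMeasurable (by fun_prop))
        (.of_forall fun z => hbound (f z.1).2))
      (hint'.mul_bdd (Measurable.aestronglyMeasurable (by fun_prop))
        (.of_forall fun z => hbound (eventValue_mem z.2))),
    hf.integral_mul_eventValue hh, sub_self]

theorem IsPosterior.integral_sq_sub_eventValue [IsFiniteMeasure μ] (hf : IsPosterior μ f)
    (hg : Measurable g) :
    ∫ z, ((g z.1 : ℝ) - eventValue z.2) ^ 2 ∂μ =
      ∫ z, ((f z.1 : ℝ) - eventValue z.2) ^ 2 ∂μ + ∫ z, (g z.1 - f z.1 : ℝ) ^ 2 ∂μ := by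
  have hmf := hf.measurable
  have hev := integrable_sub_eventValue (μ := μ) hmf
  have hloss : Integrable (fun z => ((f z.1 : ℝ) - eventValue z.2) ^ 2) μ := by
    simp_rw [sq]
    exact hev.mul_bdd hev.1 (.of_forall fun z => abs_sub_le_one (f z.1).2 (eventValue_mem z.2))
  have hcross : Integrable (fun z => (g z.1 - f z.1 : ℝ) * (f z.1 - eventValue z.2)) μ :=
    hev.bdd_mul (by fun_prop) (.of_forall fun z => abs_sub_le_one (g z.1).2 (f z.1).2)
  calc ∫ z, ((g z.1 : ℝ) - eventValue z.2) ^ 2 ∂μ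
      = ∫ z, (((f z.1 : ℝ) - eventValue z.2) ^ 2 + (g z.1 - f z.1 : ℝ) ^ 2 +
          2 * ((g z.1 - f z.1 : ℝ) * (f z.1 - eventValue z.2))) ∂μ :=
        integral_congr_ae (.of_forall fun z => by ring)
    _ = _ := by
        rw [integral_add (by exact hloss.add (integrable_sq_sub hmf hg)) (hcross.const_mul 2),
          integral_add hloss (integrable_sq_sub hmf hg), integral_const_mul,
          hf.integral_mul_sub_eventValue (h := fun a => (g a - f a : ℝ)) (by fun_prop)
            (integrable_sub hmf hg), mul_zero, add_zero]

end Loss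

section Optimal

variable {n : ℕ} {S : Fin n → Type*} [∀ i, MeasurableSpace (S i)] {P : Distribution S}
  {f g : Reports n → I} {ε : ℝ}

@[fun_prop]
theorem measurable_report (P : Distribution S) (i : Fin n) : Measurable (report P i) :=
  Measurable.subtype_mk
    (Kernel.measurable_coe _ (measurableSet_singleton true)).ennreal_toReal

theorem isPosterior_report (P : Distribution S) (i : Fin n) :
    IsPosterior ((P : Measure ((∀ j, S j) × Bool)).map (Prod.map (fun s => s i) id))
      (report P i) := by
  refine ⟨measurable_report P i, ?_⟩
  have hX : Measurable fun x : (∀ j, S j) × Bool => x.1 i := by fun_prop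
  have hφ : Measurable (Prod.map (fun s : ∀ j, S j => s i) (id : Bool → Bool)) := by fun_prop
  have hreport : ∀ s, condDistrib (fun x : (∀ j, S j) × Bool => x.2) (fun x => x.1 i)
      (P : Measure ((∀ j, S j) × Bool)) s {true} = ENNReal.ofReal (report P i s) :=
    fun s => (ofReal_measureReal (by finiteness)).symm
  ext D hD
  rw [eventPart_apply true hD, Measure.map_apply hφ (hD.prod (measurableSet_singleton true)),
    withDensity_apply _ hD, Measure.fst, Measure.map_map measurable_fst hφ,
    setLIntegral_map hD (measurable_report P i).subtype_val.ennreal_ofReal (by fun_prop)]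
  simp_rw [← hreport]
  exact (setLIntegral_preimage_condDistrib hX measurable_snd.aemeasurable
    (measurableSet_singleton true) hD).symm

theorem reportLaw_eq_map (P : Distribution S) :
    reportLaw P = (P : Measure ((∀ i, S i) × Bool)).map
      (Prod.map (fun s i => report P i (s i)) id) := rfl

instance (P : Distribution S) : IsProbabilityMeasure (reportLaw P) :=
  Measure.isProbabilityMeasure_map (by fun_prop)

theorem IsPosterior.isOptimal (hf : IsPosterior (reportLaw P) f) : IsOptimal P f := by
  refine ⟨hf.measurable, fun g hg => ?_⟩
  rw [loss, loss, hf.integral_sq_sub_eventValue hg]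
  exact le_add_of_nonneg_right (integral_nonneg fun z => sq_nonneg _)

theorem IsPosterior.ae_eq_of_isOptimal (hf : IsPosterior (reportLaw P) f) (hg : IsOptimal P g) :
    ∀ᵐ z ∂reportLaw P, g z.1 = f z.1 := by
  have hle := hg.2 f hf.measurable
  rw [loss, loss, hf.integral_sq_sub_eventValue hg.1] at hle
  have hzero : ∫ z, (g z.1 - f z.1 : ℝ) ^ 2 ∂reportLaw P = 0 :=
    le_antisymm (by linarith) (integral_nonneg fun z => sq_nonneg _)
  rw [integral_eq_zero_iff_of_nonneg (fun z => sq_nonneg _)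
    (integrable_sq_sub hf.measurable hg.1)] at hzero
  filter_upwards [hzero] with z hz
  exact Subtype.ext (sub_eq_zero.1 (pow_eq_zero_iff two_ne_zero |>.1 hz))

theorem IsPosterior.isEpsOptimal_iff (hf : IsPosterior (reportLaw P) f) :
    IsEpsOptimal P ε g ↔ ∫ z, (g z.1 - f z.1 : ℝ) ^ 2 ∂reportLaw P ≤ ε := by
  refine ⟨fun ⟨fstar, hstar, h⟩ => h.trans_eq' (integral_congr_ae ?_),
    fun h => ⟨f, hf.isOptimal, h⟩⟩
  filter_upwards [hf.ae_eq_of_isOptimal hstar] with z hz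
  rw [hz]

theorem IsPosterior.measureReal_mul_sq_sub_le (hf : IsPosterior (reportLaw P) f)
    (hg : Measurable g) (h : IsEpsOptimal P ε g) (r : Reports n) :
    (reportLaw P).fst.real {r} * (g r - f r) ^ 2 ≤ ε := by
  have hm : MeasurableSet (Prod.fst ⁻¹' {r} : Set (Sample n)) :=
    measurable_fst (measurableSet_singleton r)
  rw [measureReal_def, Measure.fst_apply (measurableSet_singleton r), ← measureReal_def]
  calc (reportLaw P).real (Prod.fst ⁻¹' {r}) * (g r - f r : ℝ) ^ 2
      = ∫ z in Prod.fst ⁻¹' {r}, (g z.1 - f z.1 : ℝ) ^ 2 ∂reportLaw P := by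
        rw [setIntegral_congr_fun hm (g := fun _ => (g r - f r : ℝ) ^ 2)
          (by rintro z rfl; rfl), setIntegral_const, smul_eq_mul]
    _ ≤ ∫ z, (g z.1 - f z.1 : ℝ) ^ 2 ∂reportLaw P :=
        setIntegral_le_integral (integrable_sq_sub hf.measurable hg)
          (.of_forall fun z => sq_nonneg _)
    _ ≤ ε := hf.isEpsOptimal_iff.1 h

theorem IsPosterior.measurableSet_isEpsOptimal {Ω : Type*} [MeasurableSpace Ω]
    (hf : IsPosterior (reportLaw P) f) {F : Ω → Reports n → I}
    (hF : Measurable fun x : Ω × Reports n => F x.1 x.2) (ε : ℝ) :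
    MeasurableSet {x | IsEpsOptimal P ε (F x)} := by
  have hmf := hf.measurable
  have : Measurable fun x : Ω × Sample n => F x.1 x.2.1 :=
    hF.comp (by fun_prop : Measurable fun x : Ω × Sample n => (x.1, x.2.1))
  have hsq : Measurable fun x : Ω × Sample n => (F x.1 x.2.1 - f x.2.1 : ℝ) ^ 2 := by fun_prop
  simp_rw [hf.isEpsOptimal_iff]
  exact measurableSet_le hsq.stronglyMeasurable.integral_prod_right'.measurable measurable_const

end Optimal

section JointLaw

variable {α β : Type*} [MeasurableSpace α] [MeasurableSpace β] {p : I} {κ : Bool → Measure α}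

/-- The law of `(a, ω)` when the event `ω` has prior probability `p` and `a ∼ κ ω` given `ω`. -/
def jointLaw (p : I) (κ : Bool → Measure α) : Measure (α × Bool) :=
  Ber(true, false, p).bind fun v => (κ v).map fun a => (a, v)

theorem outcomeProb_pos (hp : p ∈ Set.Ioo 0 1) (v : Bool) : 0 < (outcomeProb p v : ℝ) := by
  cases v
  · exact sub_pos.2 hp.2
  · exact hp.1

theorem sum_outcomeProb (p : I) : ∑ v, ENNReal.ofReal (outcomeProb p v) = 1 := by
  rw [Fintype.sum_bool, ← ENNReal.ofReal_add (outcomeProb p true).2.1 (outcomeProb p false).2.1]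
  simp [outcomeProb]

theorem lintegral_bernoulliMeasure (p : I) (h : Bool → ℝ≥0∞) :
    ∫⁻ v, h v ∂Ber(true, false, p) = ∑ v, ENNReal.ofReal (outcomeProb p v) * h v := by
  rw [bernoulliMeasure_def, lintegral_add_measure, lintegral_smul_measure,
    lintegral_smul_measure, lintegral_dirac, lintegral_dirac, Fintype.sum_bool]
  simp only [ENNReal.smul_def, smul_eq_mul, ← ENNReal.ofReal_coe_nnreal, coe_toNNReal,
    outcomeProb, if_true, Bool.false_eq_true, if_false]

theorem eventPart_jointLaw (v : Bool) :
    eventPart (jointLaw p κ) v = ENNReal.ofReal (outcomeProb p v) • κ v := by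
  ext D hD
  have hDv := hD.prod (measurableSet_singleton v)
  rw [eventPart_apply v hD, jointLaw, Measure.bind_apply hDv measurable_from_top.aemeasurable,
    lintegral_bernoulliMeasure, Finset.sum_eq_single_of_mem v (Finset.mem_univ v),
    Measure.map_apply (by fun_prop) hDv]
  · simp
  · intro u _ hu
    rw [Measure.map_apply (by fun_prop) hDv]
    simp [hu]

theorem ext_of_eventPart {μ ν : Measure (α × Bool)} (h : ∀ v, eventPart μ v = eventPart ν v) :
    μ = ν := by
  ext E hE
  rw [← lintegral_indicator_one hE, ← lintegral_indicator_one hE,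
    lintegral_eq_sum_eventPart (measurable_one.indicator hE),
    lintegral_eq_sum_eventPart (measurable_one.indicator hE)]
  simp_rw [h]

theorem jointLaw_map {φ : α → β} (hφ : Measurable φ) :
    (jointLaw p κ).map (Prod.map φ id) = jointLaw p fun v => (κ v).map φ :=
  ext_of_eventPart fun v => by
    rw [eventPart_map hφ, eventPart_jointLaw, eventPart_jointLaw, Measure.map_smul]

theorem measure_snd_eq (μ : Measure (α × Bool)) (v : Bool) :
    μ {z | z.2 = v} = eventPart μ v Set.univ := by
  rw [eventPart_apply v .univ]
  congr 1
  ext z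
  simp

theorem measure_snd_eq_jointLaw [∀ v, IsProbabilityMeasure (κ v)] (v : Bool) :
    jointLaw p κ {z | z.2 = v} = ENNReal.ofReal (outcomeProb p v) := by
  rw [measure_snd_eq, eventPart_jointLaw, Measure.smul_apply, measure_univ, smul_eq_mul, mul_one]

instance [∀ v, IsProbabilityMeasure (κ v)] : IsProbabilityMeasure (jointLaw p κ) := by
  refine ⟨Eq.trans ?_ (sum_outcomeProb p)⟩
  rw [← lintegral_one, lintegral_eq_sum_eventPart measurable_const]
  refine Finset.sum_congr rfl fun v _ => ?_
  rw [lintegral_one, eventPart_jointLaw, Measure.smul_apply, measure_univ, smul_eq_mul, mul_one]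

theorem fst_jointLaw_withDensity {M : Measure α} {d : Bool → α → ℝ≥0∞}
    (hd : ∀ v, Measurable (d v)) :
    (jointLaw p fun v => M.withDensity (d v)).fst =
      M.withDensity fun a => ∑ v, ENNReal.ofReal (outcomeProb p v) * d v a := by
  simp_rw [fst_eq_eventPart_add, eventPart_jointLaw, Fintype.sum_bool]
  rw [← withDensity_smul _ (hd _), ← withDensity_smul _ (hd _),
    ← withDensity_add_left ((hd true).const_smul _)]
  rfl

theorem isPosterior_jointLaw_withDensity {M : Measure α} {d : Bool → α → ℝ≥0∞} {f : α → I}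
    (hf : Measurable f) (hd : ∀ v, Measurable (d v))
    (hbayes : ∀ a, ENNReal.ofReal (f a) * ∑ v, ENNReal.ofReal (outcomeProb p v) * d v a =
      ENNReal.ofReal p * d true a) :
    IsPosterior (jointLaw p fun v => M.withDensity (d v)) f := by
  refine ⟨hf, ?_⟩
  have hsum : Measurable fun a => ∑ v, ENNReal.ofReal (outcomeProb p v) * d v a :=
    Finset.measurable_sum _ fun v _ => (hd v).const_mul _
  rw [fst_jointLaw_withDensity hd, eventPart_jointLaw, ← withDensity_smul _ (hd true),
    ← withDensity_mul _ hsum (by fun_prop)]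
  congr 1
  funext a
  rw [Pi.mul_apply, mul_comm, hbayes]
  rfl

theorem IsPosterior.eq_withDensity [∀ v, IsProbabilityMeasure (κ v)] {f : α → I}
    (hf : IsPosterior (jointLaw p κ) f) (hp : p ∈ Set.Ioo 0 1) (v : Bool) :
    κ v = (jointLaw p κ).fst.withDensity fun a =>
      ENNReal.ofReal (outcomeProb (f a) v / outcomeProb p v) := by
  have hmf := hf.measurable
  have hpos := outcomeProb_pos hp v
  have hinv : (ENNReal.ofReal (outcomeProb p v))⁻¹ * ENNReal.ofReal (outcomeProb p v) = 1 :=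
    ENNReal.inv_mul_cancel (ENNReal.ofReal_pos.2 hpos).ne' ENNReal.ofReal_ne_top
  calc κ v = (ENNReal.ofReal (outcomeProb p v))⁻¹ • eventPart (jointLaw p κ) v := by
        rw [eventPart_jointLaw, smul_smul, hinv, one_smul]
    _ = _ := by
        rw [hf.eventPart_eq, ← withDensity_smul _ (by fun_prop)]
        congr 1
        funext a
        rw [Pi.smul_apply, smul_eq_mul, ENNReal.ofReal_div_of_pos hpos, ENNReal.div_eq_inv_mul]

end JointLaw

section CondIndep

variable {n : ℕ} {S : Fin n → Type*} [∀ i, MeasurableSpace (S i)] {P : Distribution S}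

theorem map_fst_cond {α : Type*} [MeasurableSpace α] (μ : Measure (α × Bool)) (v : Bool) :
    (cond μ {z | z.2 = v}).map Prod.fst = (μ {z | z.2 = v})⁻¹ • eventPart μ v := by
  rw [ProbabilityTheory.cond, Measure.map_smul, eventPart]

theorem map_fst_cond_jointLaw {α : Type*} [MeasurableSpace α] {p : I} (hp : p ∈ Set.Ioo 0 1)
    (κ : Bool → Measure α) [∀ v, IsProbabilityMeasure (κ v)] (v : Bool) :
    (cond (jointLaw p κ) {z | z.2 = v}).map Prod.fst = κ v := by
  rw [map_fst_cond, measure_snd_eq_jointLaw, eventPart_jointLaw, smul_smul,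
    ENNReal.inv_mul_cancel (ENNReal.ofReal_pos.2 (outcomeProb_pos hp v)).ne'
      ENNReal.ofReal_ne_top, one_smul]

theorem eq_jointLaw {α : Type*} [MeasurableSpace α] (μ : Measure (α × Bool))
    [IsProbabilityMeasure μ] {p : I} (hp : p ∈ Set.Ioo 0 1)
    (hμ : μ.real {z | z.2 = true} = p) :
    μ = jointLaw p fun v => (cond μ {z | z.2 = v}).map Prod.fst := by
  have hprior : ∀ v, μ {z | z.2 = v} = ENNReal.ofReal (outcomeProb p v) := by
    have hcompl : {z : α × Bool | z.2 = false} = {z | z.2 = true}ᶜ := by ext; simp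
    intro v
    rw [← ofReal_measureReal]
    cases v
    · rw [hcompl, probReal_compl_eq_one_sub (measurableSet_snd_eq true), hμ]
      rfl
    · rw [hμ]
      rfl
  refine ext_of_eventPart fun v => ?_
  rw [eventPart_jointLaw, map_fst_cond, hprior, smul_smul,
    ENNReal.mul_inv_cancel (ENNReal.ofReal_pos.2 (outcomeProb_pos hp v)).ne'
      ENNReal.ofReal_ne_top, one_smul]

theorem exists_eq_jointLaw_pi (hP : P ∈ condIndepFamily S) :
    ∃ p ∈ Set.Ioo (0 : I) 1, ∃ ν : Bool → ∀ i, Measure (S i),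
      (∀ v i, IsProbabilityMeasure (ν v i)) ∧
        (P : Measure ((∀ i, S i) × Bool)) = jointLaw p fun v => Measure.pi (ν v) := by
  have hprob := fun v => (hP.2 v).isProbabilityMeasure
  have hpi := fun v => (hP.2 v).map_fun_eq_pi_map fun i => by fun_prop
  let p : I := ⟨(P : Measure ((∀ i, S i) × Bool)).real {x | x.2 = true},
    measureReal_nonneg, measureReal_le_one⟩
  exact ⟨p, hP.1, fun v i => (cond (P : Measure ((∀ i, S i) × Bool)) {x | x.2 = v}).map
      fun x => x.1 i, fun v i => Measure.isProbabilityMeasure_map (by fun_prop),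
    (eq_jointLaw _ hP.1 rfl).trans (congrArg (jointLaw p) (funext hpi))⟩

theorem mem_condIndepFamily_of_eq_jointLaw_pi {p : I} (hp : p ∈ Set.Ioo 0 1)
    (ν : Bool → ∀ i, Measure (S i)) [∀ v i, IsProbabilityMeasure (ν v i)]
    (hP : (P : Measure ((∀ i, S i) × Bool)) = jointLaw p fun v => Measure.pi (ν v)) :
    P ∈ condIndepFamily S := by
  have hne : ∀ v, jointLaw p (fun v => Measure.pi (ν v)) {x | x.2 = v} ≠ 0 := fun v => by
    rw [measure_snd_eq_jointLaw]
    exact (ENNReal.ofReal_pos.2 (outcomeProb_pos hp v)).ne'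
  refine ⟨?_, fun v => ?_⟩
  · rw [hP, measureReal_def, measure_snd_eq_jointLaw,
      ENNReal.toReal_ofReal (outcomeProb p _).2.1]
    exact hp
  · have hmap := map_fst_cond_jointLaw hp (fun v => Measure.pi (ν v)) v
    have := cond_isProbabilityMeasure (hne v)
    rw [hP, iIndepFun_iff_map_fun_eq_pi_map fun i => by fun_prop]
    refine hmap.trans (congrArg Measure.pi (funext fun i => ?_))
    calc ν v i = (Measure.pi (ν v)).map fun s => s i :=
          (measurePreserving_eval (ν v) i).map_eq.symm
      _ = _ := by
          rw [← hmap, Measure.map_map (measurable_pi_apply i) measurable_fst]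
          rfl

end CondIndep

section PiDensity

variable {ι : Type*} [Fintype ι] {α : ι → Type*}

theorem indicator_univ_pi_prod (s : ∀ i, Set (α i)) (d : ∀ i, α i → ℝ≥0∞) (x : ∀ i, α i) :
    (Set.univ.pi s).indicator (fun x => ∏ i, d i (x i)) x =
      ∏ i, (s i).indicator (d i) (x i) := by
  by_cases hx : x ∈ Set.univ.pi s
  · rw [Set.indicator_of_mem hx]
    exact Finset.prod_congr rfl fun i _ => (Set.indicator_of_mem (hx i trivial) _).symm
  · rw [Set.indicator_of_notMem hx]
    obtain ⟨i, hi⟩ : ∃ i, x i ∉ s i := by simpa [Set.mem_pi] using hx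
    exact (Finset.prod_eq_zero (Finset.mem_univ i) (Set.indicator_of_notMem hi _)).symm

variable [∀ i, MeasurableSpace (α i)]

theorem pi_withDensity (μ : ∀ i, Measure (α i)) [∀ i, IsProbabilityMeasure (μ i)]
    {d : ∀ i, α i → ℝ≥0∞} (hd : ∀ i, Measurable (d i))
    [∀ i, SigmaFinite ((μ i).withDensity (d i))] :
    Measure.pi (fun i => (μ i).withDensity (d i)) =
      (Measure.pi μ).withDensity fun x => ∏ i, d i (x i) := by
  refine Measure.pi_eq fun s hs => ?_
  have hm : ∀ i, Measurable ((s i).indicator (d i)) := fun i => (hd i).indicator (hs i)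
  rw [withDensity_apply _ (.univ_pi hs), ← lintegral_indicator (.univ_pi hs)]
  simp_rw [indicator_univ_pi_prod]
  rw [lintegral_prod_eq_prod_lintegral_of_indepFun Finset.univ
    (fun i (x : ∀ i, α i) => (s i).indicator (d i) (x i))
    (iIndepFun_pi fun i => (hm i).aemeasurable) fun i => (hm i).comp (measurable_pi_apply i)]
  refine Finset.prod_congr rfl fun i _ => ?_
  rw [withDensity_apply _ (hs i), ← lintegral_indicator (hs i)]
  exact (measurePreserving_eval μ i).lintegral_comp (hm i)

end PiDensity

section Aggregator

variable {n : ℕ}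

theorem prod_reports_nonneg (r : Reports n) : 0 ≤ ∏ i, (r i : ℝ) :=
  Finset.prod_nonneg fun i _ => (r i).2.1

theorem prod_one_sub_reports_nonneg (r : Reports n) : 0 ≤ ∏ i, (1 - (r i : ℝ)) :=
  Finset.prod_nonneg fun i _ => sub_nonneg.2 (r i).2.2

theorem div_add_mul_mem_unitInterval {a b t : ℝ} (ha : 0 ≤ a) (hb : 0 ≤ b) (ht : 0 ≤ t) :
    a / (a + t * b) ∈ I :=
  ⟨by positivity, div_le_one_of_le₀ (le_add_of_nonneg_right (by positivity)) (by positivity)⟩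

/-- The posterior probability of the event given conditionally independent reports `r`. It depends
on the prior only through the parameter `x` (see `aggregatorParam`). If one report is `0` and
another is `1`, which has probability `0`, the value is `0 / 0 = 0`. -/
def aggregator (x : ℝ) (r : Reports n) : I :=
  ⟨(∏ i, (r i : ℝ)) / (∏ i, (r i : ℝ) + Real.exp (-x) * ∏ i, (1 - (r i : ℝ))),
    div_add_mul_mem_unitInterval (prod_reports_nonneg r) (prod_one_sub_reports_nonneg r)
      (Real.exp_pos _).le⟩

/-- The parameter of the posterior `aggregator` when the prior probability of the event is `p`. -/
def aggregatorParam (n : ℕ) (p : ℝ) : ℝ := (1 - n) * Real.log (p / (1 - p))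

theorem measurable_aggregator (x : ℝ) : Measurable (aggregator (n := n) x) := by
  refine Measurable.subtype_mk ?_
  fun_prop

theorem monotone_aggregator (r : Reports n) : Monotone fun x => aggregator x r := by
  intro x y hxy
  have hA := prod_reports_nonneg r
  have hB := prod_one_sub_reports_nonneg r
  rcases hA.eq_or_lt with h0 | h0
  · simp [aggregator, ← h0]
  · refine Subtype.mk_le_mk.2 ?_
    gcongr

theorem continuous_aggregator (r : Reports n) : Continuous fun x => aggregator x r := by
  have hA := prod_reports_nonneg r
  have hB := prod_one_sub_reports_nonneg r
  refine Continuous.subtype_mk ?_ _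
  rcases hA.eq_or_lt with h0 | h0
  · simp only [← h0, zero_div]
    fun_prop
  · exact Continuous.div (by fun_prop) (by fun_prop) fun x => by positivity

theorem exp_neg_aggregatorParam (n : ℕ) {p : ℝ} (hp : p ∈ Set.Ioo (0 : ℝ) 1) :
    Real.exp (-aggregatorParam n p) = (p / (1 - p)) ^ n * ((1 - p) / p) := by
  have hodds : 0 < p / (1 - p) := div_pos hp.1 (sub_pos.2 hp.2)
  rw [aggregatorParam, show -((1 - n) * Real.log (p / (1 - p))) =
      n * Real.log (p / (1 - p)) - Real.log (p / (1 - p)) by ring, Real.exp_sub,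
    Real.exp_nat_mul, Real.exp_log hodds, ← inv_div p, div_eq_mul_inv]

theorem coe_aggregator_mul_sum {p : I} (hp : p ∈ Set.Ioo 0 1) (r : Reports n) :
    (aggregator (aggregatorParam n p) r : ℝ) *
        ∑ v, (outcomeProb p v : ℝ) * ∏ i, (outcomeProb (r i) v / outcomeProb p v : ℝ) =
      p * ∏ i, (r i / p : ℝ) := by
  have hp0 : 0 < (p : ℝ) := hp.1
  have hp1 : 0 < 1 - (p : ℝ) := sub_pos.2 hp.2
  have hA := prod_reports_nonneg r
  have hB := prod_one_sub_reports_nonneg r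
  simp only [Fintype.sum_bool, outcomeProb, if_true, Bool.false_eq_true, if_false,
    coe_symm_eq, Finset.prod_div_distrib, Finset.prod_const, Finset.card_univ, Fintype.card_fin,
    aggregator, exp_neg_aggregatorParam n hp]
  rcases hA.eq_or_lt with h0 | h0
  · simp [← h0]
  · rw [div_mul_eq_mul_div, div_eq_iff (by positivity), div_pow]
    field_simp

theorem ofReal_aggregator_mul_sum {p : I} (hp : p ∈ Set.Ioo 0 1) (r : Reports n) :
    ENNReal.ofReal (aggregator (aggregatorParam n p) r) * ∑ v, ENNReal.ofReal (outcomeProb p v) *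
        ∏ i, ENNReal.ofReal (outcomeProb (r i) v / outcomeProb p v) =
      ENNReal.ofReal p * ∏ i, ENNReal.ofReal (outcomeProb (r i) true / outcomeProb p true) := by
  have hnonneg : ∀ v i, 0 ≤ (outcomeProb (r i) v / outcomeProb p v : ℝ) := fun v i =>
    div_nonneg (outcomeProb (r i) v).2.1 (outcomeProb p v).2.1
  have hprod : ∀ v, 0 ≤ ∏ i, (outcomeProb (r i) v / outcomeProb p v : ℝ) := fun v =>
    Finset.prod_nonneg fun i _ => hnonneg v i
  simp_rw [← ENNReal.ofReal_prod_of_nonneg fun i _ => hnonneg _ i,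
    ← ENNReal.ofReal_mul (outcomeProb p _).2.1]
  rw [← ENNReal.ofReal_sum_of_nonneg fun v _ => mul_nonneg (outcomeProb p v).2.1 (hprod v),
    ← ENNReal.ofReal_mul (aggregator _ r).2.1, ← ENNReal.ofReal_mul p.2.1,
    coe_aggregator_mul_sum hp]
  rfl

variable {S : Fin n → Type*} [∀ i, MeasurableSpace (S i)] {P : Distribution S}

theorem isPosterior_aggregator {p : I} (hp : p ∈ Set.Ioo 0 1) {ν : Bool → ∀ i, Measure (S i)}
    [∀ v i, IsProbabilityMeasure (ν v i)]
    (hP : (P : Measure ((∀ i, S i) × Bool)) = jointLaw p fun v => Measure.pi (ν v)) :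
    IsPosterior (reportLaw P) (aggregator (aggregatorParam n p)) := by
  let m : ∀ i, Measure (S i) := fun i => (jointLaw p fun v => ν v i).fst
  let d : Bool → ∀ i, S i → ℝ≥0∞ := fun v i s =>
    ENNReal.ofReal (outcomeProb (report P i s) v / outcomeProb p v)
  have hd : ∀ v i, Measurable (d v i) := fun v i =>
    (((measurable_outcomeProb v).comp
      (measurable_report P i)).subtype_val.div_const _).ennreal_ofReal
  have hν : ∀ v i, (m i).withDensity (d v i) = ν v i := fun v i => by
    have h := isPosterior_report P i
    rw [hP, jointLaw_map (measurable_pi_apply i)] at h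
    simp_rw [(measurePreserving_eval (ν _) i).map_eq] at h
    exact (h.eq_withDensity hp v).symm
  have hσ : ∀ v i, SigmaFinite ((m i).withDensity (d v i)) := fun v i => by
    rw [hν]; infer_instance
  have hpi : ∀ v, Measure.pi (ν v) = (Measure.pi m).withDensity fun s => ∏ i, d v i (s i) :=
    fun v => by simp_rw [← pi_withDensity m (hd v), hν]
  rw [reportLaw_eq_map]
  refine IsPosterior.map (by fun_prop) (measurable_aggregator _) ?_
  simp_rw [hP, hpi]
  refine isPosterior_jointLaw_withDensity
    ((measurable_aggregator _).comp (by fun_prop)) (fun v => ?_)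
    fun s => ofReal_aggregator_mul_sum hp fun i => report P i (s i)
  exact Finset.measurable_prod _ fun i _ => (hd v i).comp (measurable_pi_apply i)

theorem exists_isPosterior_aggregator (hP : P ∈ condIndepFamily S) :
    ∃ x, IsPosterior (reportLaw P) (aggregator x) := by
  obtain ⟨p, hp, ν, _, hν⟩ := exists_eq_jointLaw_pi hP
  exact ⟨_, isPosterior_aggregator hp hν⟩

end Aggregator

section Hoeffding

variable {α : Type*} {T : ℕ} {X : α → ℝ} {s : ℝ}

/-- The empirical mean of `X` on the data `y`, with the value `0` if there is no data. -/
def empiricalMean (X : α → ℝ) (y : Fin T → α) : ℝ := (∑ t, X (y t)) / T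

theorem empiricalMean_neg (X : α → ℝ) (y : Fin T → α) :
    empiricalMean (fun a => -X a) y = -empiricalMean X y := by
  simp only [empiricalMean, Finset.sum_neg_distrib, neg_div]

variable [MeasurableSpace α] {μ : Measure α} [IsProbabilityMeasure μ]

theorem hasSubgaussianMGF_pi_eval (hX : Measurable X) (hb : ∀ a, |X a| ≤ 1) (t : Fin T) :
    HasSubgaussianMGF (fun y : Fin T → α => X (y t) - ∫ a, X a ∂μ) 1
      (Measure.pi fun _ : Fin T => μ) := by
  have hsub : HasSubgaussianMGF (fun a => X a - ∫ a, X a ∂μ) 1 μ := by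
    have hc : (‖(1 : ℝ) - (-1)‖₊ / 2) ^ 2 = 1 := by
      rw [← NNReal.coe_inj]
      norm_num
    rw [← hc]
    exact hasSubgaussianMGF_of_mem_Icc hX.aemeasurable (.of_forall fun a => abs_le.1 (hb a))
  refine HasSubgaussianMGF.of_map (X := fun a => X a - ∫ a, X a ∂μ)
    (measurable_pi_apply t).aemeasurable ?_
  rwa [(measurePreserving_eval (fun _ : Fin T => μ) t).map_eq]

theorem measureReal_le_empiricalMean_sub_le (hX : Measurable X) (hb : ∀ a, |X a| ≤ 1)
    (hs : 0 ≤ s) :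
    (Measure.pi fun _ : Fin T => μ).real {y | s ≤ empiricalMean X y - ∫ a, X a ∂μ} ≤
      Real.exp (-(T * s ^ 2 / 2)) := by
  rcases T.eq_zero_or_pos with rfl | hT
  · simp [measureReal_le_one]
  have hT' : (0 : ℝ) < T := by exact_mod_cast hT
  have hset : {y : Fin T → α | s ≤ empiricalMean X y - ∫ a, X a ∂μ} =
      {y | T * s ≤ ∑ t, (X (y t) - ∫ a, X a ∂μ)} := by
    ext y
    rw [Set.mem_ofPred_eq, Set.mem_ofPred_eq, empiricalMean, Finset.sum_sub_distrib,
      Finset.sum_const, Finset.card_univ, Fintype.card_fin, nsmul_eq_mul,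
      ← mul_le_mul_iff_of_pos_left hT', mul_sub, mul_div_cancel₀ _ hT'.ne']
  rw [hset]
  refine (HasSubgaussianMGF.measure_sum_ge_le_of_iIndepFun
    (iIndepFun_pi fun _ => (hX.sub_const _).aemeasurable)
    (fun t _ => hasSubgaussianMGF_pi_eval hX hb t) (by positivity)).trans_eq ?_
  simp only [Finset.sum_const, Finset.card_univ, Fintype.card_fin, nsmul_eq_mul, mul_one,
    NNReal.coe_natCast]
  congr 1
  field_simp

theorem measureReal_le_abs_empiricalMean_sub_le (hX : Measurable X) (hb : ∀ a, |X a| ≤ 1)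
    (hs : 0 ≤ s) :
    (Measure.pi fun _ : Fin T => μ).real {y | s ≤ |empiricalMean X y - ∫ a, X a ∂μ|} ≤
      2 * Real.exp (-(T * s ^ 2 / 2)) := by
  have hneg := measureReal_le_empiricalMean_sub_le (μ := μ) (T := T) hX.neg
    (fun a => by simpa using hb a) hs
  simp_rw [Pi.neg_def, empiricalMean_neg, integral_neg, sub_neg_eq_add, neg_add_eq_sub] at hneg
  calc _ = (Measure.pi fun _ : Fin T => μ).real
          ({y | s ≤ empiricalMean X y - ∫ a, X a ∂μ} ∪
            {y | s ≤ ∫ a, X a ∂μ - empiricalMean X y}) := by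
        simp only [le_abs, neg_sub, Set.ofPred_or]
    _ ≤ _ := by
        rw [two_mul]
        exact (measureReal_union_le _ _).trans
          (add_le_add (measureReal_le_empiricalMean_sub_le hX hb hs) hneg)

end Hoeffding

section MonotoneRoot

variable {m : ℝ → ℝ} {η ε : ℝ} {x₀ : ℝ}

theorem exists_upper_test_point (hm : Monotone m) (hc : Continuous m) (h₀ : m x₀ ≤ ε) :
    ∃ u, ∀ g, Monotone g → m u - g u < η → ∀ x, g x ≤ ε - η → m x ≤ ε := by
  by_cases h : ∃ x, ε < m x
  · obtain ⟨x₁, h₁⟩ := h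
    obtain ⟨u, hu⟩ : ε ∈ Set.range m := mem_range_of_exists_le_of_exists_ge hc ⟨x₀, h₀⟩ ⟨x₁, h₁.le⟩
    refine ⟨u, fun g hg hgu x hx => ?_⟩
    by_contra! hlt
    have hux : u ≤ x := (hm.reflect_lt (hu ▸ hlt)).le
    linarith [hg hux]
  · exact ⟨x₀, fun g _ _ x _ => not_lt.1 fun hx => h ⟨x, hx⟩⟩

theorem exists_lower_test_point (hm : Monotone m) (hc : Continuous m) (h₀ : -ε ≤ m x₀) :
    ∃ u, ∀ g, Monotone g → g u - m u < η → ∀ x, -(ε - η) ≤ g x → -ε ≤ m x := by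
  have hrefl : ∀ {g : ℝ → ℝ}, Monotone g → Monotone fun x => -g (-x) := fun hg _ _ h =>
    neg_le_neg (hg (neg_le_neg h))
  obtain ⟨u, hu⟩ := exists_upper_test_point (η := η) (x₀ := -x₀) (hrefl hm)
    (hc.comp continuous_neg).neg (by simpa using neg_le.1 h₀)
  refine ⟨-u, fun g hg hgu x hx => neg_le.1 ?_⟩
  simpa using hu _ (hrefl hg) (by linarith) (-x) (by simpa using neg_le.1 hx)

/-- Thanks to monotonicity, closeness of `g` to `m` at three points replaces uniform closeness. -/
theorem exists_test_points (hm : Monotone m) (hc : Continuous m) (h₀ : m x₀ = 0) (hη : 0 < η) :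
    ∃ u : Fin 3 → ℝ, ∀ g, Monotone g → (∀ i, |g (u i) - m (u i)| < η) →
      (∃ k, |g (TopologicalSpace.denseSeq ℝ k)| ≤ 2 * η) ∧
        ∀ x, |g x| ≤ 2 * η → |m x| ≤ 3 * η := by
  obtain ⟨u, hu⟩ := exists_upper_test_point (x₀ := x₀) (ε := 3 * η) (η := η) hm hc (by linarith)
  obtain ⟨v, hv⟩ := exists_lower_test_point (x₀ := x₀) (ε := 3 * η) (η := η) hm hc (by linarith)
  obtain ⟨k, hk⟩ := (TopologicalSpace.denseRange_denseSeq ℝ).exists_mem_open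
    (isOpen_lt hc.abs continuous_const) ⟨x₀, show |m x₀| < η by simpa [h₀] using hη⟩
  refine ⟨![u, v, TopologicalSpace.denseSeq ℝ k], fun g hg hclose => ⟨⟨k, ?_⟩, fun x hx => ?_⟩⟩
  · have hw : |g (TopologicalSpace.denseSeq ℝ k) - m (TopologicalSpace.denseSeq ℝ k)| < η :=
      hclose 2
    linarith [abs_sub_abs_le_abs_sub (g (TopologicalSpace.denseSeq ℝ k))
      (m (TopologicalSpace.denseSeq ℝ k)), hk.out]
  · have hgu : |g u - m u| < η := hclose 0
    have hgv : |g v - m v| < η := hclose 1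
    have hx' := abs_le.1 hx
    exact abs_le.2 ⟨hv g hg (abs_lt.1 hgv).2 x (by linarith),
      hu g hg (by linarith [(abs_lt.1 hgu).1]) x (by linarith)⟩

end MonotoneRoot

section RootEstimation

variable {α : Type*} {X : ℝ → α → ℝ} {T : ℕ} {η : ℝ}

theorem exists_index_imp (X : ℝ → α → ℝ) (η : ℝ) (y : Fin T → α) :
    ∃ k, (∃ l, |empiricalMean (X (TopologicalSpace.denseSeq ℝ l)) y| ≤ η) →
      |empiricalMean (X (TopologicalSpace.denseSeq ℝ k)) y| ≤ η := by
  by_cases h : ∃ l, |empiricalMean (X (TopologicalSpace.denseSeq ℝ l)) y| ≤ η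
  · exact h.imp fun _ hk _ => hk
  · exact ⟨0, fun h' => absurd h' h⟩

open Classical in
/-- The index of the first parameter in a dense sequence at which the empirical mean is at most `η`
in absolute value, and `0` if there is none. -/
def rootIndex (X : ℝ → α → ℝ) (η : ℝ) (y : Fin T → α) : ℕ := Nat.find (exists_index_imp X η y)

theorem abs_empiricalMean_rootIndex_le {y : Fin T → α}
    (h : ∃ k, |empiricalMean (X (TopologicalSpace.denseSeq ℝ k)) y| ≤ η) :
    |empiricalMean (X (TopologicalSpace.denseSeq ℝ (rootIndex X η y))) y| ≤ η := by
  classical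
  exact Nat.find_spec (exists_index_imp X η y) h

variable [MeasurableSpace α] {μ : Measure α}

/-- A family of random variables bounded by `1` which is increasing and continuous in a real
parameter. The parameter of mean zero is to be estimated from data. -/
structure IsMonotoneFamily (X : ℝ → α → ℝ) : Prop where
  measurable : ∀ x, Measurable (X x)
  monotone : ∀ a, Monotone fun x => X x a
  continuous : ∀ a, Continuous fun x => X x a
  abs_le_one : ∀ x a, |X x a| ≤ 1

theorem IsMonotoneFamily.monotone_empiricalMean (hX : IsMonotoneFamily X) (y : Fin T → α) :
    Monotone fun x => empiricalMean (X x) y := fun _ _ hxy =>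
  div_le_div_of_nonneg_right (Finset.sum_le_sum fun t _ => hX.monotone (y t) hxy) T.cast_nonneg

theorem IsMonotoneFamily.integrable [IsFiniteMeasure μ] (hX : IsMonotoneFamily X) (x : ℝ) :
    Integrable (X x) μ :=
  .of_bound (hX.measurable x).aestronglyMeasurable 1 (.of_forall (hX.abs_le_one x))

theorem IsMonotoneFamily.monotone_integral [IsFiniteMeasure μ] (hX : IsMonotoneFamily X) :
    Monotone fun x => ∫ a, X x a ∂μ := fun _ _ hxy =>
  integral_mono (hX.integrable _) (hX.integrable _) fun a => hX.monotone a hxy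

theorem IsMonotoneFamily.continuous_integral [IsFiniteMeasure μ] (hX : IsMonotoneFamily X) :
    Continuous fun x => ∫ a, X x a ∂μ :=
  continuous_of_dominated (fun x => (hX.measurable x).aestronglyMeasurable)
    (fun x => .of_forall (hX.abs_le_one x)) (integrable_const 1) (.of_forall hX.continuous)

theorem measurable_rootIndex (hX : ∀ x, Measurable (X x)) :
    Measurable (rootIndex (T := T) X η) := by
  classical
  have hmean : ∀ k, Measurable fun y : Fin T → α =>
      empiricalMean (X (TopologicalSpace.denseSeq ℝ k)) y := fun k => by
    unfold empiricalMean
    fun_prop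
  refine measurable_find _ fun k => ?_
  have hle : ∀ k, Measurable fun y : Fin T → α =>
      |empiricalMean (X (TopologicalSpace.denseSeq ℝ k)) y| ≤ η := fun k =>
    measurableSet_setOfPred.1 (measurableSet_le (hmean k).abs measurable_const)
  exact measurableSet_setOfPred.2 ((Measurable.exists hle).imp (hle k))

theorem IsMonotoneFamily.measureReal_lt_abs_integral_rootIndex_le [IsProbabilityMeasure μ]
    (hX : IsMonotoneFamily X) {x₀ : ℝ} (h₀ : ∫ a, X x₀ a ∂μ = 0) (hη : 0 < η) :
    (Measure.pi fun _ : Fin T => μ).real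
        {y | 3 * η < |∫ a, X (TopologicalSpace.denseSeq ℝ (rootIndex X (2 * η) y)) a ∂μ|} ≤
      6 * Real.exp (-(T * η ^ 2 / 2)) := by
  obtain ⟨u, hu⟩ := exists_test_points (hX.monotone_integral (μ := μ)) hX.continuous_integral h₀ hη
  have hsub : {y : Fin T → α |
      3 * η < |∫ a, X (TopologicalSpace.denseSeq ℝ (rootIndex X (2 * η) y)) a ∂μ|} ⊆
      ⋃ i, {y | η ≤ |empiricalMean (X (u i)) y - ∫ a, X (u i) a ∂μ|} := by
    intro y hy
    by_contra hclose
    simp only [Set.mem_iUnion, Set.mem_ofPred_eq, not_exists, not_le] at hclose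
    obtain ⟨hex, hroot⟩ := hu _ (hX.monotone_empiricalMean y) hclose
    exact absurd (hroot _ (abs_empiricalMean_rootIndex_le hex)) (not_le.2 hy)
  calc _ ≤ (Measure.pi fun _ : Fin T => μ).real
          (⋃ i, {y | η ≤ |empiricalMean (X (u i)) y - ∫ a, X (u i) a ∂μ|}) := measureReal_mono hsub
    _ ≤ ∑ i, (Measure.pi fun _ : Fin T => μ).real
          {y | η ≤ |empiricalMean (X (u i)) y - ∫ a, X (u i) a ∂μ|} :=
        measureReal_iUnion_fintype_le _
    _ ≤ ∑ _i : Fin 3, 2 * Real.exp (-(T * η ^ 2 / 2)) := Finset.sum_le_sum fun i _ =>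
        measureReal_le_abs_empiricalMean_sub_le (hX.measurable _) (hX.abs_le_one _) hη.le
    _ = 6 * Real.exp (-(T * η ^ 2 / 2)) := by
        rw [Finset.sum_const, Finset.card_univ, Fintype.card_fin, nsmul_eq_mul]
        ring

end RootEstimation

section PredictionError

variable {α : Type*} [MeasurableSpace α] {μ : Measure (α × Bool)}

theorem IsPosterior.integral_sub_eventValue [IsFiniteMeasure μ] {f : α → I}
    (hf : IsPosterior μ f) : ∫ z, ((f z.1 : ℝ) - eventValue z.2) ∂μ = 0 := by
  simpa using hf.integral_mul_sub_eventValue (h := fun _ => 1) measurable_const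
    (integrable_const 1)

theorem IsPosterior.integral_sq_sub_le_abs_integral [IsFiniteMeasure μ] {f g : α → I}
    (hf : IsPosterior μ f) (hg : Measurable g) (hcomp : f ≤ g ∨ g ≤ f) :
    ∫ z, (g z.1 - f z.1 : ℝ) ^ 2 ∂μ ≤ |∫ z, ((g z.1 : ℝ) - eventValue z.2) ∂μ| := by
  have hmf := hf.measurable
  have hgint := integrable_sub_eventValue (μ := μ) hg
  have hfint := integrable_sub_eventValue (μ := μ) hmf
  have hdiff : Integrable (fun z => (g z.1 - f z.1 : ℝ)) μ := by
    simpa only [Pi.sub_def, sub_sub_sub_cancel_right] using hgint.sub hfint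
  calc ∫ z, (g z.1 - f z.1 : ℝ) ^ 2 ∂μ ≤ ∫ z, |(g z.1 - f z.1 : ℝ)| ∂μ := by
        refine integral_mono (integrable_sq_sub hmf hg) hdiff.abs fun z => ?_
        rw [← sq_abs]
        exact pow_le_of_le_one (abs_nonneg _) (abs_sub_le_one (g z.1).2 (f z.1).2) two_ne_zero
    _ = |∫ z, (g z.1 - f z.1 : ℝ) ∂μ| := by
        rcases hcomp with h | h
        · have hnonneg : ∀ z : α × Bool, 0 ≤ (g z.1 - f z.1 : ℝ) := fun z => sub_nonneg.2 (h z.1)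
          simp_rw [abs_of_nonneg (hnonneg _)]
          exact (abs_of_nonneg (integral_nonneg hnonneg)).symm
        · have hnonpos : ∀ z : α × Bool, (g z.1 - f z.1 : ℝ) ≤ 0 := fun z => sub_nonpos.2 (h z.1)
          simp_rw [abs_of_nonpos (hnonpos _), integral_neg]
          exact (abs_of_nonpos (integral_nonpos hnonpos)).symm
    _ = |∫ z, ((g z.1 : ℝ) - eventValue z.2) ∂μ| := by
        rw [← sub_zero (∫ z, ((g z.1 : ℝ) - eventValue z.2) ∂μ), ← hf.integral_sub_eventValue,
          ← integral_sub hgint hfint]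
        simp_rw [sub_sub_sub_cancel_right]

/-- The signed error of the forecast `F x` of the event. -/
def predictionError (F : ℝ → α → I) (x : ℝ) (z : α × Bool) : ℝ := F x z.1 - eventValue z.2

theorem isMonotoneFamily_predictionError {F : ℝ → α → I} (hmeas : ∀ x, Measurable (F x))
    (hmono : Monotone F) (hcont : ∀ a, Continuous fun x => F x a) :
    IsMonotoneFamily (predictionError F) where
  measurable x := by
    have := hmeas x
    unfold predictionError
    fun_prop
  monotone z x y hxy := by
    have hle : (F x z.1 : ℝ) ≤ F y z.1 := hmono hxy z.1
    exact sub_le_sub_right hle _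
  continuous z := by
    have := hcont z.1
    unfold predictionError
    fun_prop
  abs_le_one x z := abs_sub_le_one (F x z.1).2 (eventValue_mem z.2)

end PredictionError

section UpperBound

variable {n T : ℕ} {S : Fin n → Type*} [∀ i, MeasurableSpace (S i)] {Q : Set (Distribution S)}
  {ε δ η : ℝ}

theorem samplesSuffice_of_le_pi {F : (Fin T → Sample n) → Reports n → I}
    (hF : Measurable fun z : (Fin T → Sample n) × Reports n => F z.1 z.2)
    (h : ∀ P ∈ Q, ENNReal.ofReal (1 - δ) ≤
      Measure.pi (fun _ : Fin T => reportLaw P) {y | IsEpsOptimal P ε (F y)}) :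
    SamplesSuffice Q ε δ T := by
  let A : Learner n T :=
    { Seed := Unit
      measurableSpaceSeed := inferInstance
      seedLaw := ⟨Measure.dirac (), inferInstance⟩
      output := fun _ => F
      measurable_output := hF.comp measurable_snd }
  refine ⟨A, fun P hP => (h P hP).trans_eq ?_⟩
  have hset : {x : A.Seed × (Fin T → Sample n) | IsEpsOptimal P ε (A.output x.1 x.2)} =
      Set.univ ×ˢ {y | IsEpsOptimal P ε (F y)} := by
    ext x
    simp [A]
  rw [hset, trainingLaw, Measure.prod_prod, measure_univ, one_mul]

/-- The forecast `1 / 2`. -/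
def halfReport : I := ⟨1 / 2, by norm_num, by norm_num⟩

theorem samplesSuffice_of_quarter_le (hε : 1 / 4 ≤ ε) (hδ : 0 ≤ δ) (T : ℕ) :
    SamplesSuffice (condIndepFamily S) ε δ T := by
  refine samplesSuffice_of_le_pi (F := fun _ _ => halfReport) measurable_const fun P hP => ?_
  obtain ⟨x, hx⟩ := exists_isPosterior_aggregator hP
  have hsq : ∀ z : Sample n, (halfReport - aggregator x z.1 : ℝ) ^ 2 ≤ 1 / 4 := fun z => by
    have h := (aggregator x z.1).2
    rw [halfReport]
    nlinarith [h.1, h.2]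
  have hopt : IsEpsOptimal P ε fun _ => halfReport :=
    hx.isEpsOptimal_iff.2 <| calc
      ∫ z, (halfReport - aggregator x z.1 : ℝ) ^ 2 ∂reportLaw P ≤ ∫ _z, 1 / 4 ∂reportLaw P :=
        integral_mono (integrable_sq_sub hx.measurable measurable_const) (integrable_const _) hsq
      _ ≤ ε := by simpa using hε
  have huniv : {_y : Fin T → Sample n | IsEpsOptimal P ε fun _ => halfReport} = Set.univ :=
    Set.eq_univ_of_forall fun _ => hopt
  rw [huniv, measure_univ]
  exact ENNReal.ofReal_le_one.2 (by linarith)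

theorem isMonotoneFamily_predictionError_aggregator :
    IsMonotoneFamily (predictionError (aggregator (n := n))) :=
  isMonotoneFamily_predictionError measurable_aggregator
    (fun _ _ hxy r => monotone_aggregator r hxy) continuous_aggregator

/-- The learner's output: an aggregator whose mean forecast on the data is close to the empirical
frequency of the event. -/
def calibratedAggregator (η : ℝ) (y : Fin T → Sample n) : Reports n → I :=
  aggregator (TopologicalSpace.denseSeq ℝ (rootIndex (predictionError aggregator) η y))

theorem measurable_calibratedAggregator :
    Measurable fun z : (Fin T → Sample n) × Reports n => calibratedAggregator η z.1 z.2 := by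
  have hcount : Measurable fun q : ℕ × Reports n =>
      aggregator (TopologicalSpace.denseSeq ℝ q.1) q.2 :=
    measurable_from_prod_countable_right fun k => by
      exact measurable_aggregator (TopologicalSpace.denseSeq ℝ k)
  have hindex := measurable_rootIndex (T := T) (η := η)
    (isMonotoneFamily_predictionError_aggregator (n := n)).measurable
  exact hcount.comp (hindex.prodMap measurable_id)

theorem samplesSuffice_of_exp_le (hη : 0 < η) (h : 6 * Real.exp (-(T * η ^ 2 / 2)) ≤ δ) :
    SamplesSuffice (condIndepFamily S) (3 * η) δ T := by
  refine samplesSuffice_of_le_pi (F := calibratedAggregator (2 * η))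
    measurable_calibratedAggregator fun P hP => ?_
  obtain ⟨x, hx⟩ := exists_isPosterior_aggregator hP
  let good : Set (Fin T → Sample n) := {y | IsEpsOptimal P (3 * η) (calibratedAggregator (2 * η) y)}
  have hgood : MeasurableSet good :=
    hx.measurableSet_isEpsOptimal measurable_calibratedAggregator _
  have hbad : goodᶜ ⊆ {y | 3 * η < |∫ z, predictionError aggregator
      (TopologicalSpace.denseSeq ℝ (rootIndex (predictionError aggregator) (2 * η) y)) z
        ∂reportLaw P|} := by
    intro y hy
    by_contra hle
    refine hy (hx.isEpsOptimal_iff.2 ((hx.integral_sq_sub_le_abs_integral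
      (measurable_aggregator _) ?_).trans (not_lt.1 hle)))
    exact (le_total _ _).imp (fun h r => monotone_aggregator r h) fun h r => monotone_aggregator r h
  have hprob := (measureReal_mono hbad).trans
    (isMonotoneFamily_predictionError_aggregator.measureReal_lt_abs_integral_rootIndex_le
      hx.integral_sub_eventValue hη)
  rw [probReal_compl_eq_one_sub hgood] at hprob
  exact ENNReal.ofReal_le_of_le_toReal (by change _ ≤ Measure.real _ good; linarith)

theorem samplesSuffice_of_log_le (hε : 0 < ε) (hδ : 0 < δ)
    (hT : 18 / ε ^ 2 * Real.log (6 / δ) ≤ T) : SamplesSuffice (condIndepFamily S) ε δ T := by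
  rw [← mul_div_cancel₀ ε three_ne_zero]
  refine samplesSuffice_of_exp_le (by positivity) ?_
  rw [← le_div_iff₀' (by norm_num), Real.exp_neg, inv_le_comm₀ (by positivity) (by positivity),
    inv_div, ← Real.log_le_iff_le_exp (by positivity)]
  rw [div_mul_eq_mul_div, div_le_iff₀ (by positivity)] at hT
  linarith

theorem sampleComplexity_le_of_forall_le {x : ℝ} (hx : 0 ≤ x)
    (h : ∀ T : ℕ, x ≤ T → SamplesSuffice Q ε δ T) :
    (sampleComplexity Q ε δ : ℝ≥0∞) ≤ ENNReal.ofReal (x + 1) := by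
  have hle : sampleComplexity Q ε δ ≤ ⌈x⌉₊ := iInf₂_le _ fun T hT => h T (Nat.ceil_le.1 hT)
  calc (sampleComplexity Q ε δ : ℝ≥0∞) ≤ (⌈x⌉₊ : ℝ≥0∞) := by exact_mod_cast ENat.toENNReal_le.2 hle
    _ = ENNReal.ofReal ⌈x⌉₊ := (ENNReal.ofReal_natCast _).symm
    _ ≤ ENNReal.ofReal (x + 1) := ENNReal.ofReal_le_ofReal (Nat.ceil_lt_add_one hx).le

theorem sampleComplexity_condIndepFamily_le (hε : 0 < ε) (hδ : 0 < δ) (hδ' : δ < 1) :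
    (sampleComplexity (condIndepFamily S) ε δ : ℝ≥0∞) ≤
      ENNReal.ofReal (37 * (1 / ε ^ 2 * Real.log (1 / (ε * δ)))) := by
  rcases le_or_gt (1 / 4) ε with hε' | hε'
  · have hzero : sampleComplexity (condIndepFamily S) ε δ ≤ (0 : ℕ) :=
      iInf₂_le 0 fun T _ => samplesSuffice_of_quarter_le hε' hδ.le T
    simp [nonpos_iff_eq_zero.1 hzero]
  have hlog : Real.log (6 / δ) ≤ 2 * Real.log (1 / (ε * δ)) := by
    have hε2 : ε ^ 2 ≤ 1 / 16 := by nlinarith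
    calc Real.log (6 / δ) ≤ Real.log ((1 / (ε * δ)) ^ 2) := by
          refine Real.log_le_log (by positivity) ?_
          rw [div_pow, div_le_div_iff₀ hδ (by positivity)]
          nlinarith [mul_le_mul_of_nonneg_right hδ'.le hδ.le]
      _ = 2 * Real.log (1 / (ε * δ)) := by rw [Real.log_pow, Nat.cast_ofNat]
  have hone : 1 ≤ 1 / ε ^ 2 * Real.log (1 / (ε * δ)) := by
    refine one_le_mul_of_one_le_of_one_le ?_ ?_
    · rw [le_div_iff₀ (by positivity)]
      nlinarith
    · rw [Real.le_log_iff_exp_le (by positivity), le_div_iff₀ (by positivity)]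
      nlinarith [Real.exp_one_lt_three, mul_pos hε hδ]
  refine (sampleComplexity_le_of_forall_le (mul_nonneg (by positivity) (Real.log_nonneg ?_))
    fun T hT => samplesSuffice_of_log_le hε hδ hT).trans (ENNReal.ofReal_le_ofReal ?_)
  · rw [le_div_iff₀ hδ]; linarith
  · calc 18 / ε ^ 2 * Real.log (6 / δ) + 1
        ≤ 18 / ε ^ 2 * (2 * Real.log (1 / (ε * δ))) + 1 / ε ^ 2 * Real.log (1 / (ε * δ)) := by
          gcongr
      _ = 37 * (1 / ε ^ 2 * Real.log (1 / (ε * δ))) := by ring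

end UpperBound

section ChiSquare

variable {α β : Type*} [MeasurableSpace α] [MeasurableSpace β] {K K' : ℝ≥0∞} {Q P : Measure α}

/-- The bound `χ²(Q ∥ P) + 1 ≤ K`, in its dual form; it implies `Q ≪ P` when `K` is finite. -/
def ChiSqBound (K : ℝ≥0∞) (Q P : Measure α) : Prop :=
  ∀ f : α → ℝ≥0∞, Measurable f → (∫⁻ a, f a ∂Q) ^ 2 ≤ K * ∫⁻ a, f a ^ 2 ∂P

theorem chiSqBound_withDensity (P : Measure α) {d : α → ℝ≥0∞} (hd : Measurable d) :
    ChiSqBound (∫⁻ a, d a ^ 2 ∂P) (P.withDensity d) P := by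
  intro f hf
  have hsq : ∀ x : ℝ≥0∞, (x ^ (1 / 2 : ℝ)) ^ 2 = x := fun x => by
    rw [← ENNReal.rpow_natCast, ← ENNReal.rpow_mul]
    norm_num
  have hholder := ENNReal.lintegral_mul_le_Lp_mul_Lq P Real.HolderConjugate.two_two
    hd.aemeasurable hf.aemeasurable
  simp only [ENNReal.rpow_ofNat] at hholder
  rw [lintegral_withDensity_eq_lintegral_mul _ hd hf]
  exact (pow_le_pow_left' hholder 2).trans_eq (by rw [mul_pow, hsq, hsq])

theorem chiSqBound_self (P : Measure α) [IsProbabilityMeasure P] : ChiSqBound 1 P P := by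
  simpa using chiSqBound_withDensity P (d := 1) measurable_one

theorem ChiSqBound.mono (h : ChiSqBound K Q P) (hK : K ≤ K') : ChiSqBound K' Q P :=
  fun f hf => (h f hf).trans (by gcongr)

theorem ChiSqBound.apply_sq_le (h : ChiSqBound K Q P) {E : Set α} (hE : MeasurableSet E) :
    Q E ^ 2 ≤ K * P E := by
  have hsq : ∀ a, E.indicator (1 : α → ℝ≥0∞) a ^ 2 = E.indicator 1 a := fun a => by
    by_cases ha : a ∈ E <;> simp [ha]
  simpa only [hsq, lintegral_indicator_one hE] using h _ (measurable_one.indicator hE)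

theorem ChiSqBound.map (h : ChiSqBound K Q P) {g : α → β} (hg : Measurable g) :
    ChiSqBound K (Q.map g) (P.map g) := by
  intro f hf
  rw [lintegral_map hf hg, lintegral_map (hf.pow_const 2) hg]
  exact h _ (hf.comp hg)

theorem ChiSqBound.bind (h : ChiSqBound K Q P) {κ' κ : α → Measure β} (hκ' : Measurable κ')
    (hκ : Measurable κ) (hκκ : ∀ a, ChiSqBound K' (κ' a) (κ a)) :
    ChiSqBound (K * K') (Q.bind κ') (P.bind κ) := by
  intro f hf
  rw [Measure.lintegral_bind hκ'.aemeasurable hf.aemeasurable,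
    Measure.lintegral_bind hκ.aemeasurable (hf.pow_const 2).aemeasurable]
  calc (∫⁻ a, ∫⁻ b, f b ∂κ' a ∂Q) ^ 2
      ≤ K * ∫⁻ a, (∫⁻ b, f b ∂κ' a) ^ 2 ∂P :=
        h _ ((Measure.measurable_lintegral hf).comp hκ')
    _ ≤ K * ∫⁻ a, K' * ∫⁻ b, f b ^ 2 ∂κ a ∂P := by
        gcongr with a
        exact hκκ a f hf
    _ = K * K' * ∫⁻ a, ∫⁻ b, f b ^ 2 ∂κ a ∂P := by
        have hm : Measurable fun a => ∫⁻ b, f b ^ 2 ∂κ a :=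
          (Measure.measurable_lintegral (hf.pow_const 2)).comp hκ
        rw [lintegral_const_mul _ hm, mul_assoc]

theorem ChiSqBound.prod {Q' P' : Measure β} [SFinite Q'] [SFinite P'] (h : ChiSqBound K Q P)
    (h' : ChiSqBound K' Q' P') : ChiSqBound (K * K') (Q.prod Q') (P.prod P') := by
  rw [Measure.prod, Measure.prod]
  exact h.bind Measurable.map_prodMk_left Measurable.map_prodMk_left fun _ =>
    h'.map measurable_prodMk_left

theorem ChiSqBound.pi [SigmaFinite Q] [SigmaFinite P] (h : ChiSqBound K Q P) (n : ℕ) :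
    ChiSqBound (K ^ n) (Measure.pi fun _ : Fin n => Q) (Measure.pi fun _ : Fin n => P) := by
  induction n with
  | zero =>
    rw [Measure.pi_of_empty (fun _ : Fin 0 => Q) Fin.elim0,
      Measure.pi_of_empty (fun _ : Fin 0 => P) Fin.elim0, pow_zero]
    exact chiSqBound_self _
  | succ n ih =>
    rw [pow_succ', ← ((measurePreserving_piFinSuccAbove (fun _ => Q) 0).symm).map_eq,
      ← ((measurePreserving_piFinSuccAbove (fun _ => P) 0).symm).map_eq]
    exact (h.prod ih).map (MeasurableEquiv.measurable _)

theorem bernoulliMeasure_eq_withDensity {p : I} (hp : p ∈ Set.Ioo 0 1) (p' : I) :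
    Ber(true, false, p') = Ber(true, false, p).withDensity fun v =>
      ENNReal.ofReal (outcomeProb p' v / outcomeProb p v) := by
  refine Measure.ext_of_lintegral _ fun f hf => ?_
  rw [lintegral_withDensity_eq_lintegral_mul _ measurable_from_top hf, lintegral_bernoulliMeasure,
    lintegral_bernoulliMeasure]
  refine Finset.sum_congr rfl fun v _ => ?_
  have hpos := outcomeProb_pos hp v
  rw [Pi.mul_apply, ← mul_assoc, ← ENNReal.ofReal_mul hpos.le, mul_div_cancel₀ _ hpos.ne']

theorem chiSqBound_bernoulliMeasure (x y : α) {p : I} (hp : p ∈ Set.Ioo 0 1) (p' : I) :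
    ChiSqBound (ENNReal.ofReal (1 + (p' - p) ^ 2 / (p * (1 - p))))
      Ber(x, y, p') Ber(x, y, p) := by
  have hmap : ∀ r : I, Ber(x, y, r) = Ber(true, false, r).map fun v => cond v x y := fun r => by
    rw [map_bernoulliMeasure' _ _ measurable_from_top]
    rfl
  rw [hmap, hmap]
  refine ChiSqBound.map ?_ measurable_from_top
  rw [bernoulliMeasure_eq_withDensity hp p']
  refine (chiSqBound_withDensity _ measurable_from_top).mono (le_of_eq ?_)
  have hpos := outcomeProb_pos hp
  rw [lintegral_bernoulliMeasure]
  simp_rw [← ENNReal.ofReal_pow (div_nonneg (outcomeProb p' _).2.1 (outcomeProb p _).2.1),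
    ← ENNReal.ofReal_mul (outcomeProb p _).2.1]
  rw [← ENNReal.ofReal_sum_of_nonneg fun v _ => by have := (hpos v).le; positivity]
  congr 1
  have h0 := (hpos true).ne'
  have h1 := (hpos false).ne'
  simp only [outcomeProb, if_true, Bool.false_eq_true, if_false, coe_symm_eq,
    Fintype.sum_bool] at h0 h1 ⊢
  field_simp
  ring

end ChiSquare

section TwoPoint

variable {α : Type*} [MeasurableSpace α] {K : ℝ≥0∞} {Q P : Measure α} {δ : ℝ}

theorem ChiSqBound.one_sub_sq_le (h : ChiSqBound K Q P) [IsProbabilityMeasure P] {E F : Set α}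
    (hE : MeasurableSet E) (hEF : Disjoint E F) (hδ : δ ≤ 1) (hQ : ENNReal.ofReal (1 - δ) ≤ Q E)
    (hP : ENNReal.ofReal (1 - δ) ≤ P F) :
    ENNReal.ofReal ((1 - δ) ^ 2) ≤ K * ENNReal.ofReal δ := by
  have hPE : P E ≤ ENNReal.ofReal δ := by
    calc P E ≤ 1 - P F := by
          refine ENNReal.le_sub_of_add_le_right (measure_ne_top _ _) ?_
          rw [← measure_union' hEF hE]
          exact prob_le_one
      _ ≤ 1 - ENNReal.ofReal (1 - δ) := tsub_le_tsub_left hP 1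
      _ = ENNReal.ofReal δ := by
          rw [← ENNReal.ofReal_one, ← ENNReal.ofReal_sub _ (by linarith), sub_sub_cancel]
  rw [ENNReal.ofReal_pow (by linarith)]
  calc ENNReal.ofReal (1 - δ) ^ 2 ≤ Q E ^ 2 := by gcongr
    _ ≤ K * P E := h.apply_sq_le hE
    _ ≤ K * ENNReal.ofReal δ := by gcongr

end TwoPoint

section LowerBound

variable {n : ℕ} {S : Fin n → Type*} [∀ i, MeasurableSpace (S i)] {F : Set (Distribution S)}
  {P P' : Distribution S} {ε δ : ℝ} {T : ℕ}

theorem SamplesSuffice.one_sub_sq_le {K : ℝ≥0∞} (h : SamplesSuffice F ε δ T) (hδ : δ ≤ 1)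
    (hP : P ∈ F) (hP' : P' ∈ F) (hK : ChiSqBound K (reportLaw P') (reportLaw P))
    {f : Reports n → I} (hf : IsPosterior (reportLaw P') f)
    (hdisj : ∀ g : Reports n → I, Measurable g → IsEpsOptimal P' ε g → ¬IsEpsOptimal P ε g) :
    ENNReal.ofReal ((1 - δ) ^ 2) ≤ K ^ T * ENNReal.ofReal δ := by
  obtain ⟨A, hA⟩ := h
  have hout : Measurable fun z : (A.Seed × (Fin T → Sample n)) × Reports n =>
      A.output z.1.1 z.1.2 z.2 := A.measurable_output.comp
      (by fun_prop : Measurable fun z : (A.Seed × (Fin T → Sample n)) × Reports n =>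
        (z.1.1, z.1.2, z.2))
  have hchi : ChiSqBound (K ^ T) (trainingLaw A P') (trainingLaw A P) := by
    rw [← one_mul (K ^ T)]
    exact (chiSqBound_self (A.seedLaw : Measure A.Seed)).prod (hK.pi T)
  have : IsProbabilityMeasure (trainingLaw A P) := by
    unfold trainingLaw; infer_instance
  exact hchi.one_sub_sq_le (hf.measurableSet_isEpsOptimal hout ε)
    (Set.disjoint_left.2 fun x => hdisj _ (hout.comp measurable_prodMk_left)) hδ
    (hA P' hP') (hA P hP)

theorem le_sampleComplexity_of_forall_le {x : ℝ}
    (h : ∀ T : ℕ, SamplesSuffice F ε δ T → x ≤ T) :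
    ENNReal.ofReal x ≤ (sampleComplexity F ε δ : ℝ≥0∞) := by
  have hle : (⌈x⌉₊ : ℕ∞) ≤ sampleComplexity F ε δ :=
    le_iInf₂ fun N hN => by exact_mod_cast Nat.ceil_le.2 (h N (hN N le_rfl))
  calc ENNReal.ofReal x ≤ ENNReal.ofReal ⌈x⌉₊ := ENNReal.ofReal_le_ofReal (Nat.le_ceil x)
    _ = (⌈x⌉₊ : ℝ≥0∞) := ENNReal.ofReal_natCast _
    _ ≤ (sampleComplexity F ε δ : ℝ≥0∞) := by exact_mod_cast ENat.toENNReal_le.2 hle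

end LowerBound

section HardInstance

variable {n : ℕ} {S : Fin n → Type*} [∀ i, MeasurableSpace (S i)] {P : Distribution S} {q q' : I}

theorem reportLaw_eq_jointLaw_pi {p : I} (hp : p ∈ Set.Ioo 0 1) {ν : Bool → ∀ i, Measure (S i)}
    [∀ v i, IsProbabilityMeasure (ν v i)]
    (hP : (P : Measure ((∀ i, S i) × Bool)) = jointLaw p fun v => Measure.pi (ν v))
    {f : ∀ i, S i → I} (hf : ∀ i, IsPosterior (jointLaw p fun v => ν v i) (f i)) :
    reportLaw P = jointLaw p fun v => Measure.pi fun i => (ν v i).map (f i) := by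
  have hmap : ∀ v i, (ν v i).map (report P i) = (ν v i).map (f i) := fun v i => by
    have hreport := isPosterior_report P i
    rw [hP, jointLaw_map (measurable_pi_apply i)] at hreport
    simp_rw [(measurePreserving_eval _ i).map_eq] at hreport
    have hac : ν v i ≪ (jointLaw p fun v => ν v i).fst := by
      rw [(hf i).eq_withDensity hp v]
      exact withDensity_absolutelyContinuous _ _
    exact Measure.map_congr (hac.ae_eq (hreport.ae_eq (hf i)))
  have : ∀ v i, IsProbabilityMeasure ((ν v i).map (report P i)) := fun v i =>
    Measure.isProbabilityMeasure_map (by fun_prop)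
  rw [reportLaw_eq_map, hP, jointLaw_map (by fun_prop)]
  simp_rw [Measure.pi_map_pi fun i => (measurable_report P i).aemeasurable, hmap]

/-- The law of a signal given the value `v` of the event in the hard instance: always `b` if the
event occurs; otherwise `b` with probability `q` and `a` with probability `1 - q`. -/
def signalLaw {α : Type*} [MeasurableSpace α] (a b : α) (q : I) (v : Bool) : Measure α :=
  Ber(b, a, if v then 1 else q)

instance {α : Type*} [MeasurableSpace α] (a b : α) (q : I) (v : Bool) :
    IsProbabilityMeasure (signalLaw a b q v) := by
  unfold signalLaw; infer_instance

/-- The prior with odds `q`, for which the signal `b` of `signalLaw a b q` carries the forecast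
`1 / 2`, whatever `q` is. -/
def hardPrior (q : I) : I :=
  ⟨q / (1 + q), unitInterval.div_mem q.2.1 (by linarith [q.2.1]) (by linarith)⟩

/-- The law of `(r, ω)` in the hard instance. -/
def hardLaw (n : ℕ) (q : I) : Measure (Sample n) :=
  jointLaw (hardPrior q) fun v => Measure.pi fun _ => signalLaw 0 halfReport q v

instance (n : ℕ) (q : I) : IsProbabilityMeasure (hardLaw n q) := by
  unfold hardLaw; infer_instance

theorem hardPrior_mem (hq : q ∈ Set.Ioo 0 1) : hardPrior q ∈ Set.Ioo 0 1 := by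
  have hq0 : (0 : ℝ) < q := hq.1
  have h0 : (0 : ℝ) < q / (1 + q) := by positivity
  have h1 : (q / (1 + q) : ℝ) < 1 := by rw [div_lt_one (by linarith)]; linarith
  exact ⟨h0, h1⟩

theorem one_sub_hardPrior (q : I) : (1 - hardPrior q : ℝ) = 1 / (1 + q) := by
  have : (1 + q : ℝ) ≠ 0 := by linarith [q.2.1]
  simp only [hardPrior]
  field_simp
  ring

theorem signalLaw_true {α : Type*} [MeasurableSpace α] (a b : α) (q : I) :
    signalLaw a b q true = Measure.dirac b := by
  simp [signalLaw]

theorem map_signalLaw {α β : Type*} [MeasurableSpace α] [MeasurableSpace β] (a b : α) (q : I)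
    (v : Bool) {f : α → β} (hf : Measurable f) :
    (signalLaw a b q v).map f = signalLaw (f a) (f b) q v :=
  map_bernoulliMeasure' _ _ hf _

theorem isPosterior_signalLaw {α : Type*} [MeasurableSpace α] {a b : α} {A : Set α}
    [DecidablePred (· ∈ A)] (hA : MeasurableSet A) (ha : a ∈ A) (hb : b ∉ A) (q : I) :
    IsPosterior (jointLaw (hardPrior q) (signalLaw a b q))
      fun s => if s ∈ A then 0 else halfReport := by
  let c : Bool → I := fun v => if v then 1 else q
  let d : Bool → α → ℝ≥0∞ := fun v s => if s ∈ A then ENNReal.ofReal (σ (c v)) else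
    ENNReal.ofReal (c v)
  have hd : ∀ v, Measurable (d v) := fun v => .ite hA measurable_const measurable_const
  have hlaw : signalLaw a b q =
      fun v => (Measure.dirac b + Measure.dirac a).withDensity (d v) := by
    funext v
    rw [withDensity_add_measure, dirac_withDensity' (hd v), dirac_withDensity' (hd v), signalLaw,
      bernoulliMeasure_def]
    simp only [d, if_pos ha, if_neg hb, ← coe_toNNReal, ENNReal.ofReal_coe_nnreal]
    rfl
  rw [hlaw]
  refine isPosterior_jointLaw_withDensity (.ite hA measurable_const measurable_const) hd
    fun s => ?_
  by_cases hs : s ∈ A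
  · simp [d, c, hs]
  · have hq : (0 : ℝ) < 1 + q := by linarith [q.2.1]
    simp only [d, c, if_neg hs, Fintype.sum_bool, outcomeProb, if_true, Bool.false_eq_true,
      if_false, halfReport, coe_symm_eq, one_sub_hardPrior, ← ENNReal.ofReal_mul (hardPrior q).2.1,
      ← ENNReal.ofReal_mul (one_div_pos.2 hq).le]
    rw [← ENNReal.ofReal_add, ← ENNReal.ofReal_mul]
    · congr 1
      simp only [hardPrior, Set.Icc.coe_one]
      ring
    · exact halfReport.2.1
    · exact mul_nonneg (hardPrior q).2.1 zero_le_one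
    · exact mul_nonneg (one_div_pos.2 hq).le q.2.1

variable (n) in
theorem exists_reportLaw_eq_hardLaw
    (hS : ∀ i, ∃ A : Set (S i), MeasurableSet A ∧ A.Nonempty ∧ Aᶜ.Nonempty)
    (hq : q ∈ Set.Ioo 0 1) :
    ∃ P ∈ condIndepFamily S, reportLaw P = hardLaw n q ∧
      IsPosterior (reportLaw P) (aggregator (aggregatorParam n (hardPrior q))) := by
  classical
  choose A hA hne hne' using hS
  choose a ha using hne
  choose b hb using hne'
  let ν : Bool → ∀ i, Measure (S i) := fun v i => signalLaw (a i) (b i) q v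
  let P : Distribution S := ⟨jointLaw (hardPrior q) fun v => Measure.pi (ν v), inferInstance⟩
  have hp := hardPrior_mem hq
  refine ⟨P, mem_condIndepFamily_of_eq_jointLaw_pi hp ν rfl, ?_, isPosterior_aggregator hp rfl⟩
  have hf : ∀ i, Measurable fun s => if s ∈ A i then (0 : I) else halfReport := fun i =>
    .ite (hA i) measurable_const measurable_const
  have hmap : ∀ v i, (signalLaw (a i) (b i) q v).map
      (fun s => if s ∈ A i then (0 : I) else halfReport) = signalLaw 0 halfReport q v := by
    intro v i
    rw [map_signalLaw _ _ _ _ (hf i), if_pos (ha i), if_neg (hb i)]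
  rw [reportLaw_eq_jointLaw_pi hp rfl fun i => isPosterior_signalLaw (hA i) (ha i) (hb i) q]
  simp_rw [hmap, hardLaw]

theorem coe_hardPrior_le_measureReal (n : ℕ) (q : I) :
    (hardPrior q : ℝ) ≤ (hardLaw n q).fst.real {fun _ => halfReport} := by
  have hle : ENNReal.ofReal (hardPrior q) ≤ (hardLaw n q).fst {fun _ => halfReport} := by
    rw [fst_eq_eventPart_add, Measure.add_apply, hardLaw, eventPart_jointLaw]
    refine le_add_right (le_of_eq ?_)
    simp [signalLaw_true, Measure.pi_singleton, outcomeProb]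
  exact (ENNReal.ofReal_le_iff_le_toReal (by finiteness)).1 hle

theorem coe_aggregator_halfReport (x : ℝ) :
    (aggregator x fun _ : Fin n => halfReport : ℝ) = Real.sigmoid x := by
  have h : (1 / 2 : ℝ) ^ n ≠ 0 := by positivity
  simp only [aggregator, halfReport, sub_half, Finset.prod_const, Finset.card_univ,
    Fintype.card_fin, Real.sigmoid_def]
  field_simp

theorem aggregatorParam_hardPrior (n : ℕ) (q : I) :
    aggregatorParam n (hardPrior q) = (1 - n) * Real.log q := by
  rw [aggregatorParam, one_sub_hardPrior]
  have hq1 : (1 + q : ℝ) ≠ 0 := by linarith [q.2.1]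
  simp only [hardPrior]
  congr 2
  field_simp

theorem chiSqBound_hardLaw (n : ℕ) (hq : q ∈ Set.Ioo 0 1) (q' : I) :
    ChiSqBound (ENNReal.ofReal (1 + (q' - q) ^ 2 / (q * (1 - q))) ^ (n + 1))
      (hardLaw n q') (hardLaw n q) := by
  have hq0 : (0 : ℝ) < q := hq.1
  have hq1 : (0 : ℝ) < 1 - q := sub_pos.2 hq.2
  have hq0' : (0 : ℝ) ≤ q' := q'.2.1
  have hprior : ((hardPrior q' : ℝ) - hardPrior q) ^ 2 / (hardPrior q * (1 - hardPrior q)) ≤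
      (q' - q) ^ 2 / (q * (1 - q)) := by
    have h : ((hardPrior q' : ℝ) - hardPrior q) ^ 2 / (hardPrior q * (1 - hardPrior q)) =
        (q' - q) ^ 2 / (q * (1 + q') ^ 2) := by
      rw [one_sub_hardPrior]
      simp only [hardPrior]
      field_simp
      ring
    rw [h]
    gcongr
    nlinarith
  rw [pow_succ']
  refine ChiSqBound.bind ((chiSqBound_bernoulliMeasure _ _ (hardPrior_mem hq) _).mono
    (by gcongr)) measurable_from_top measurable_from_top fun v => (ChiSqBound.pi ?_ n).map
      measurable_prodMk_right
  cases v
  · exact chiSqBound_bernoulliMeasure _ _ hq q'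
  · rw [signalLaw_true, signalLaw_true]
    refine (chiSqBound_self _).mono (ENNReal.one_le_ofReal.2 ?_)
    have : 0 ≤ (q' - q : ℝ) ^ 2 / (q * (1 - q)) := by positivity
    linarith

end HardInstance

section TwoHardInstances

theorem sq_exp_neg_sub_div_le {t u : ℝ} (ht : 0 < t) (hu : 0 ≤ u) :
    (Real.exp (-(t + u)) - Real.exp (-t)) ^ 2 / (Real.exp (-t) * (1 - Real.exp (-t))) ≤
      u ^ 2 / t := by
  have hexp : t ≤ Real.exp t - 1 := by linarith [Real.add_one_le_exp t]
  have h0 : 0 ≤ 1 - Real.exp (-u) := by linarith [Real.exp_le_one_iff.2 (neg_nonpos.2 hu)]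
  have h1 : 1 - Real.exp (-u) ≤ u := by linarith [Real.one_sub_le_exp_neg u]
  calc (Real.exp (-(t + u)) - Real.exp (-t)) ^ 2 / (Real.exp (-t) * (1 - Real.exp (-t)))
      = (1 - Real.exp (-u)) ^ 2 / (Real.exp t - 1) := by
        have hne : Real.exp t - 1 ≠ 0 := by linarith
        rw [neg_add, Real.exp_add, Real.exp_neg t]
        field_simp
        ring
    _ ≤ u ^ 2 / t := by gcongr

theorem mul_exp_neg_div_four_le_sigmoid_sub {x y : ℝ} (hx : 0 ≤ x) (hxy : x ≤ y) :
    (y - x) * Real.exp (-y) / 4 ≤ Real.sigmoid y - Real.sigmoid x := by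
  have hpos := Real.exp_pos
  have hx1 : Real.exp (-x) ≤ 1 := Real.exp_le_one_iff.2 (neg_nonpos.2 hx)
  have hy1 : Real.exp (-y) ≤ 1 := Real.exp_le_one_iff.2 (neg_nonpos.2 (hx.trans hxy))
  have hnum : (y - x) * Real.exp (-y) ≤ Real.exp (-x) - Real.exp (-y) := by
    rw [show -x = (y - x) + -y by ring, Real.exp_add]
    nlinarith [Real.add_one_le_exp (y - x), hpos (-y)]
  have hden : (1 + Real.exp (-x)) * (1 + Real.exp (-y)) ≤ 4 := by
    nlinarith [hpos (-x), hpos (-y)]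
  calc (y - x) * Real.exp (-y) / 4
      ≤ (Real.exp (-x) - Real.exp (-y)) / ((1 + Real.exp (-x)) * (1 + Real.exp (-y))) := by
        have : 0 ≤ (y - x) * Real.exp (-y) := mul_nonneg (sub_nonneg.2 hxy) (hpos _).le
        gcongr
        exact this.trans hnum
    _ = Real.sigmoid y - Real.sigmoid x := by
        rw [Real.sigmoid_def, Real.sigmoid_def]
        field_simp
        ring

theorem log_one_div_le_of_sq_one_sub_le {δ t : ℝ} (hδ : 0 < δ) (hδ' : δ ≤ 1 / 4)
    (h : (1 - δ) ^ 2 ≤ Real.exp t * δ) : Real.log (1 / δ) ≤ 2 * t := by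
  have hfour : δ ≤ (1 - δ) ^ 4 := by
    calc δ ≤ (3 / 4) ^ 4 := by linarith
      _ ≤ (1 - δ) ^ 4 := by gcongr; linarith
  have hsq : δ ≤ δ * (Real.exp (2 * t) * δ) := by
    calc δ ≤ ((1 - δ) ^ 2) ^ 2 := by rwa [← pow_mul]
      _ ≤ (Real.exp t * δ) ^ 2 := by gcongr
      _ = δ * (Real.exp (2 * t) * δ) := by rw [two_mul, Real.exp_add]; ring
  rw [Real.log_le_iff_le_exp (by positivity), div_le_iff₀ hδ]
  exact (le_mul_iff_one_le_right hδ).1 hsq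

theorem one_div_eight_le_exp_neg {s : ℝ} (hs : s ≤ 2) : 1 / 8 ≤ Real.exp (-s) := by
  have h : Real.exp 1 ^ 2 ≤ 8 := by
    nlinarith [Real.exp_one_lt_d9, Real.exp_pos 1]
  rw [Real.exp_neg, one_div]
  gcongr
  calc Real.exp s ≤ Real.exp 2 := by gcongr
    _ = Real.exp 1 ^ 2 := by rw [← Real.exp_nat_mul]; norm_num
    _ ≤ 8 := h

variable {n : ℕ} {S : Fin n → Type*} [∀ i, MeasurableSpace (S i)] {ε δ κ s : ℝ} {q q' : I}

theorem mem_Ioo_of_eq_exp_neg {t : ℝ} (ht : 0 < t) (hq : (q : ℝ) = Real.exp (-t)) :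
    q ∈ Set.Ioo 0 1 := by
  have h0 : (0 : ℝ) < q := hq ▸ Real.exp_pos _
  have h1 : (q : ℝ) < 1 := hq ▸ Real.exp_lt_one_iff.2 (neg_neg_of_pos ht)
  exact ⟨h0, h1⟩

theorem chiSqBound_hardLaw_exp (hn : 2 ≤ n) (hκ : 0 ≤ κ)
    (hq : (q : ℝ) = Real.exp (-(1 / (n - 1)))) (hq' : (q' : ℝ) = Real.exp (-((1 + κ) / (n - 1)))) :
    ChiSqBound (ENNReal.ofReal (Real.exp (3 * κ ^ 2))) (hardLaw n q') (hardLaw n q) := by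
  have hn' : (2 : ℝ) ≤ n := by exact_mod_cast hn
  have ht : (0 : ℝ) < 1 / (n - 1) := one_div_pos.2 (by linarith)
  have hmem := mem_Ioo_of_eq_exp_neg ht hq
  have hsq : (q' - q : ℝ) ^ 2 / (q * (1 - q)) ≤ κ ^ 2 * (1 / (n - 1)) := by
    have hle := sq_exp_neg_sub_div_le ht (mul_nonneg hκ ht.le)
    rw [← one_add_mul, ← mul_div_assoc, mul_one, ← hq, ← hq'] at hle
    refine hle.trans_eq ?_
    field_simp
  have hnonneg : 0 ≤ (q' - q : ℝ) ^ 2 / (q * (1 - q)) :=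
    div_nonneg (sq_nonneg _) (mul_nonneg q.2.1 (sub_nonneg.2 q.2.2))
  refine (chiSqBound_hardLaw n hmem q').mono ?_
  rw [← ENNReal.ofReal_pow (by linarith)]
  gcongr
  calc (1 + (q' - q : ℝ) ^ 2 / (q * (1 - q))) ^ (n + 1)
      ≤ Real.exp (κ ^ 2 * (1 / (n - 1))) ^ (n + 1) := by
        gcongr
        linarith [Real.add_one_le_exp (κ ^ 2 * (1 / (n - 1) : ℝ))]
    _ = Real.exp (κ ^ 2 * ((n + 1) / (n - 1))) := by
        rw [← Real.exp_nat_mul]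
        push_cast
        ring_nf
    _ ≤ Real.exp (3 * κ ^ 2) := by
        rw [mul_comm 3]
        gcongr
        rw [div_le_iff₀ (by linarith)]
        linarith

theorem sq_sub_sigmoid_le_of_isEpsOptimal {P : Distribution S} (hn : 2 ≤ n) (hs : 0 < s)
    (hs' : s ≤ 2) (hq : (q : ℝ) = Real.exp (-(s / (n - 1)))) (hP : reportLaw P = hardLaw n q)
    (hf : IsPosterior (reportLaw P) (aggregator (aggregatorParam n (hardPrior q))))
    {g : Reports n → I} (hg : Measurable g) (h : IsEpsOptimal P ε g) :
    ((g fun _ => halfReport : ℝ) - Real.sigmoid s) ^ 2 ≤ 9 * ε := by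
  have hn' : (1 : ℝ) ≤ n - 1 := by
    have : (2 : ℝ) ≤ n := by exact_mod_cast hn
    linarith
  have hparam : aggregatorParam n (hardPrior q) = s := by
    rw [aggregatorParam_hardPrior, hq, Real.log_exp]
    field_simp
    ring
  have hmass : 1 / 9 ≤ (hardPrior q : ℝ) := by
    have hq8 : 1 / 8 ≤ (q : ℝ) := hq ▸ one_div_eight_le_exp_neg ((div_le_self hs.le hn').trans hs')
    simp only [hardPrior]
    rw [le_div_iff₀ (by linarith)]
    linarith
  have hle := hf.measureReal_mul_sq_sub_le hg h fun _ => halfReport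
  rw [hP, hparam, coe_aggregator_halfReport] at hle
  nlinarith [coe_hardPrior_le_measureReal n q,
    sq_nonneg ((g fun _ => halfReport : ℝ) - Real.sigmoid s)]

theorem exists_hardLaw_and_sq_sub_sigmoid_le (hn : 2 ≤ n)
    (hS : ∀ i, ∃ A : Set (S i), MeasurableSet A ∧ A.Nonempty ∧ Aᶜ.Nonempty) (hs : 0 < s)
    (hs' : s ≤ 2) :
    ∃ P ∈ condIndepFamily S, ∃ q : I, (q : ℝ) = Real.exp (-(s / (n - 1))) ∧
      reportLaw P = hardLaw n q ∧ ∀ ε, ∀ g : Reports n → I, Measurable g → IsEpsOptimal P ε g →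
        ((g fun _ => halfReport : ℝ) - Real.sigmoid s) ^ 2 ≤ 9 * ε := by
  have hn' : (2 : ℝ) ≤ n := by exact_mod_cast hn
  have ht : 0 < s / (n - 1) := div_pos hs (by linarith)
  let q : I := ⟨Real.exp (-(s / (n - 1))), (Real.exp_pos _).le,
    Real.exp_le_one_iff.2 (neg_nonpos.2 ht.le)⟩
  obtain ⟨P, hP, hPq, hf⟩ :=
    exists_reportLaw_eq_hardLaw n hS (mem_Ioo_of_eq_exp_neg (q := q) ht rfl)
  exact ⟨P, hP, q, rfl, hPq, fun ε g hg =>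
    sq_sub_sigmoid_le_of_isEpsOptimal hn hs hs' rfl hPq hf hg⟩

theorem div_le_sigmoid_one_add_sub (hκ : 0 ≤ κ) (hκ' : κ ≤ 1) :
    κ / 32 ≤ Real.sigmoid (1 + κ) - Real.sigmoid 1 := by
  have hexp := one_div_eight_le_exp_neg (s := 1 + κ) (by linarith)
  have hsigmoid := mul_exp_neg_div_four_le_sigmoid_sub zero_le_one (y := 1 + κ) (by linarith)
  rw [add_sub_cancel_left] at hsigmoid
  nlinarith

theorem SamplesSuffice.log_one_div_le {T : ℕ} (h : SamplesSuffice (condIndepFamily S) ε δ T)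
    (hn : 2 ≤ n) (hS : ∀ i, ∃ A : Set (S i), MeasurableSet A ∧ A.Nonempty ∧ Aᶜ.Nonempty)
    (hε : 0 < ε) (hε' : ε ≤ 1 / 2 ^ 16) (hδ : 0 < δ) (hδ' : δ ≤ 1 / 4) :
    Real.log (1 / δ) ≤ 2 ^ 19 * ε * T := by
  obtain ⟨κ, hκ, hκε⟩ : ∃ κ : ℝ, 0 ≤ κ ∧ κ ^ 2 = 2 ^ 16 * ε :=
    ⟨√(2 ^ 16 * ε), Real.sqrt_nonneg _, Real.sq_sqrt (by positivity)⟩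
  have hκ1 : κ ≤ 1 := by nlinarith
  obtain ⟨P, hP, q, hq, hPq, hclose⟩ :=
    exists_hardLaw_and_sq_sub_sigmoid_le hn hS zero_lt_one one_le_two
  obtain ⟨P', hP', q', hq', hPq', hclose'⟩ :=
    exists_hardLaw_and_sq_sub_sigmoid_le hn hS (s := 1 + κ) (by linarith) (by linarith)
  obtain ⟨x, hf⟩ := exists_isPosterior_aggregator hP'
  have hgap := div_le_sigmoid_one_add_sub hκ hκ1
  have hdisj : ∀ g : Reports n → I, Measurable g → IsEpsOptimal P' ε g → ¬IsEpsOptimal P ε g := by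
    intro g hg hopt' hopt
    have hsq : (κ / 32) ^ 2 ≤ (Real.sigmoid (1 + κ) - Real.sigmoid 1) ^ 2 := by gcongr
    nlinarith [hclose ε g hg hopt, hclose' ε g hg hopt',
      sq_nonneg (2 * (g fun _ => halfReport : ℝ) - Real.sigmoid (1 + κ) - Real.sigmoid 1)]
  have hchi := chiSqBound_hardLaw_exp hn hκ hq hq'
  rw [← hPq, ← hPq'] at hchi
  have hpow := h.one_sub_sq_le (by linarith) hP hP' hchi hf hdisj
  rw [← ENNReal.ofReal_pow (Real.exp_pos _).le, ← ENNReal.ofReal_mul (by positivity),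
    ENNReal.ofReal_le_ofReal_iff (by positivity), ← Real.exp_nat_mul] at hpow
  calc Real.log (1 / δ) ≤ 2 * (T * (3 * κ ^ 2)) := log_one_div_le_of_sq_one_sub_le hδ hδ' hpow
    _ ≤ 2 ^ 19 * ε * T := by
        have : 0 ≤ ε * T := by positivity
        rw [hκε]
        linarith

theorem le_sampleComplexity_condIndepFamily (hn : 2 ≤ n)
    (hS : ∀ i, ∃ A : Set (S i), MeasurableSet A ∧ A.Nonempty ∧ Aᶜ.Nonempty) (hε : 0 < ε)
    (hε' : ε ≤ 1 / 2 ^ 16) (hδ : 0 < δ) (hδ' : δ ≤ 1 / 4) :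
    ENNReal.ofReal (1 / 2 ^ 19 * (1 / ε * Real.log (1 / δ))) ≤
      (sampleComplexity (condIndepFamily S) ε δ : ℝ≥0∞) := by
  refine le_sampleComplexity_of_forall_le fun T hT => ?_
  have hlog := hT.log_one_div_le hn hS hε hε' hδ hδ'
  rw [one_div_mul_eq_div, one_div_mul_eq_div, div_div, div_le_iff₀ (by positivity)]
  linarith

end TwoHardInstances

end

end ForecastAggregation

theorem theorem5p2 :
    ∃ C c ε₀ δ₀ : ℝ, 0 < C ∧ 0 < c ∧ ε₀ ∈ Set.Ioo (0 : ℝ) 1 ∧ δ₀ ∈ Set.Ioo (0 : ℝ) 1 ∧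
      ∀ (n : ℕ), 2 ≤ n → ∀ (S : Fin n → Type*) [∀ i, MeasurableSpace (S i)],
        (∀ ε δ : ℝ, 0 < ε → ε < 1 → 0 < δ → δ < 1 →
          (ForecastAggregation.sampleComplexity
              (ForecastAggregation.condIndepFamily S) ε δ : ℝ≥0∞) ≤
            ENNReal.ofReal (C * (1 / ε ^ 2 * Real.log (1 / (ε * δ))))) ∧
        ((∀ i, ∃ A : Set (S i), MeasurableSet A ∧ A.Nonempty ∧ Aᶜ.Nonempty) →
          ∀ ε δ : ℝ, 0 < ε → ε ≤ ε₀ → 0 < δ → δ ≤ δ₀ →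
            ENNReal.ofReal (c * (1 / ε * Real.log (1 / δ))) ≤
              (ForecastAggregation.sampleComplexity
                (ForecastAggregation.condIndepFamily S) ε δ : ℝ≥0∞)) := by
  refine ⟨37, 1 / 2 ^ 19, 1 / 2 ^ 16, 1 / 4, by norm_num, by norm_num, by norm_num, by norm_num,
    fun n hn S _ => ⟨fun ε δ hε _ hδ hδ' => ?_, fun hS ε δ hε hε' hδ hδ' => ?_⟩⟩
  · exact ForecastAggregation.sampleComplexity_condIndepFamily_le hε hδ hδ'
  · exact ForecastAggregation.le_sampleComplexity_condIndepFamily hn hS hε hε' hδ hδ'
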